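/- **Model.** Let $\lambda>0$, $0<\rho\le 1$, $M\ge 1$ an integer, $\alpha>2$, $\xi>0$, and let $m_s,m_i$ be positive integers. A typical node sits at the origin of $\mathbb R^2$; the other nodes have locations $X_1,X_2,\dots$ forming a homogeneous Poisson point process on $\mathbb R^2$ with density $\lambda$. In one time slot every node, including the typical one, independently transmits with probability $\rho$ and otherwise receives; each transmitting node uses one of $M$ orthogonal resource blocks, chosen uniformly at random. The fading power gain $h_j$ of the signal of node $j$ when it is the desired signal, and its gain $g_j$ when it is an interfering signal, follow Nakagami-$m$ fading with parameters $m_s$ and $m_i$ respectively: $h_j$ is Gamma distributed with shape $m_s$ and mean $1$, i.e. $\Pr\{h_j>x\}=e^{-m_sx}\sum_{k=0}^{m_s-1}\frac{(m_sx)^k}{k!}$ for $x\ge 0$, and $g_j$ is Gamma distributed with shape $m_i$ and mean $1$. The pairs $(h_j,g_j)$ are independent for different $j$ (while $h_j$ and $g_j$ for the same $j$ may be dependent), and locations, transmission decisions, resource blocks and fading are independent of each other. For noise power $\sigma^2$ (relative to the common transmit power) the received SINR of a transmitting node $i$ at the typical node is $$\Xi_i=\frac{|X_i|^{-\alpha}h_i}{\sum_{j}|X_j|^{-\alpha}g_j+\sigma^2},$$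 where the sum runs over all nodes $j\ne i$ that transmit on the same resource block as node $i$. The typical node successfully discovers node $i$ if the typical node receives, node $i$ transmits, and $\Xi_i>\xi$. Let $S$ be the number of nodes that the typical node discovers in the time slot (over all $M$ resource blocks). **Proposition.** If $\sigma^2=0$, then $$\mathbb E\{S\}=\frac{\Delta_s(m_s,\alpha)}{\Delta_i(m_i,\alpha)}\,\frac{M(1-\rho)}{\xi^{2/\alpha}},$$ where $$\Delta_s(m_s,\alpha)=m_s^{-2/\alpha}\,\frac{\Gamma(m_s+\frac2\alpha)}{\Gamma(1+\frac2\alpha)\,\Gamma(m_s)},\qquad \Delta_i(m_i,\alpha)=m_i^{-2/\alpha}\,\frac{\Gamma(1-\frac2\alpha)\,\Gamma(m_i+\frac2\alpha)}{\Gamma(m_i)}.$$ In particular, if $m_s=m_i$, then $$\mathbb E\{S\}=\frac{\sin(2\pi/\alpha)}{2\pi/\alpha}\,\frac{M(1-\rho)}{\xi^{2/\alpha}},$$ which depends neither on the fading parameter nor on the density $\lambda$. -/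

import Mathlib

open MeasureTheory ProbabilityTheory
open scoped NNReal ENNReal

/-- The plane `ℝ²` with its Euclidean norm and Lebesgue measure. -/
abbrev Plane : Type := EuclideanSpace ℝ (Fin 2)

/-- The number of indices `j` for which the random point `X j` lies in `A`. -/
noncomputable def pointCount {Ω : Type*} (X : ℕ → Ω → Plane) (A : Set Plane) (ω : Ω) : ℕ∞ :=
  {j : ℕ | X j ω ∈ A}.encard

/-- The random points `X 0, X 1, …` enumerate a homogeneous Poisson point process on the plane
with density `lam`: the number of points in a Borel set of finite area is Poisson distributed with
mean `lam` times the area, and the numbers of points in disjoint Borel sets are independent.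
(For `lam > 0` such a process has almost surely infinitely many points, so that it can be
enumerated by `ℕ`.) -/
structure IsHomogeneousPPP {Ω : Type*} [MeasurableSpace Ω] (P : Measure Ω) (lam : ℝ≥0)
    (X : ℕ → Ω → Plane) : Prop where
  measurable : ∀ j, Measurable (X j)
  count_law : ∀ A : Set Plane, MeasurableSet A → volume A ≠ ∞ →
    P.map (pointCount X A) =
      (poissonMeasure (lam * (volume A).toNNReal)).map (fun n : ℕ => (n : ℕ∞))
  count_indep : ∀ (n : ℕ) (A : Fin n → Set Plane), (∀ k, MeasurableSet (A k)) →
    Pairwise (fun k l => Disjoint (A k) (A l)) → iIndepFun (fun k => pointCount X (A k)) P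

/-- The random quantities of one time slot of the multichannel random hello protocol with `M`
resource blocks, seen from a typical node at the origin. The other nodes are indexed by `ℕ`. -/
structure HelloNetwork (Ω : Type*) (M : ℕ) where
  /-- whether the typical node transmits (`true`) or receives (`false`) -/
  Z₀ : Ω → Bool
  /-- locations of the nodes -/
  X : ℕ → Ω → Plane
  /-- whether node `j` transmits (`true`) or receives (`false`) -/
  Z : ℕ → Ω → Bool
  /-- the resource block that node `j` uses when it transmits -/
  B : ℕ → Ω → Fin M
  /-- fading power gain of the signal of node `j` when this is the desired signal -/
  h : ℕ → Ω → ℝ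
  /-- fading power gain of the signal of node `j` when this is an interfering signal -/
  g : ℕ → Ω → ℝ

namespace HelloNetwork

variable {Ω : Type*} {M : ℕ}

/-- The nodes that interfere with the signal of node `i`: the other nodes that transmit on the
resource block of node `i`. -/
def interferers (N : HelloNetwork Ω M) (i : ℕ) (ω : Ω) : Set ℕ :=
  {j | j ≠ i ∧ N.Z j ω = true ∧ N.B j ω = N.B i ω}

/-- The aggregate interference power (per unit transmit power) against the signal of node `i`,
with path loss exponent `α`. -/
noncomputable def interference (N : HelloNetwork Ω M) (α : ℝ) (i : ℕ) (ω : Ω) : ℝ≥0∞ :=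
  ∑' j : N.interferers i ω, ENNReal.ofReal (‖N.X j ω‖ ^ (-α) * N.g j ω)

/-- The received SINR at the typical node of the packet of node `i`, where `noise` is the noise
power divided by the transmit power. In `ℝ≥0∞`, a positive number divided by `0` is `∞`. -/
noncomputable def sinr (N : HelloNetwork Ω M) (α : ℝ) (noise : ℝ≥0) (i : ℕ) (ω : Ω) : ℝ≥0∞ :=
  ENNReal.ofReal (‖N.X i ω‖ ^ (-α) * N.h i ω) / (N.interference α i ω + noise)

/-- The set of nodes that the typical node successfully discovers: the typical node receives, the
target node transmits, and its packet arrives with SINR above the threshold `ξ`. -/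
def discovered (N : HelloNetwork Ω M) (α : ℝ) (noise : ℝ≥0) (ξ : ℝ) (ω : Ω) : Set ℕ :=
  {i | N.Z₀ ω = false ∧ N.Z i ω = true ∧ ENNReal.ofReal ξ < N.sinr α noise i ω}

/-- The number `S` of nodes that the typical node successfully discovers, over all `M` resource
blocks of the time slot. -/
noncomputable def numDiscovered (N : HelloNetwork Ω M) (α : ℝ) (noise : ℝ≥0) (ξ : ℝ) (ω : Ω) :
    ℕ∞ :=
  (N.discovered α noise ξ ω).encard

/-- The mean `𝔼{S}` of the number of discovered nodes. -/
noncomputable def meanDiscovered [MeasurableSpace Ω] (P : Measure Ω) (N : HelloNetwork Ω M)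
    (α : ℝ) (noise : ℝ≥0) (ξ : ℝ) : ℝ≥0∞ :=
  ∫⁻ ω, (N.numDiscovered α noise ξ ω : ℝ≥0∞) ∂P

/-- The marks of node `j`: its mode, its resource block, and its two fading power gains. -/
def mark (N : HelloNetwork Ω M) (j : ℕ) (ω : Ω) : Bool × Fin M × ℝ × ℝ :=
  (N.Z j ω, N.B j ω, N.h j ω, N.g j ω)

/-- The probabilistic model: the nodes form a homogeneous Poisson point process with density `lam`;
every node (the typical node included) transmits with probability `ρ`; a resource block is chosen
uniformly among the `M` ones; desired and interfering signals undergo Nakagami fading with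
parameters `ms` and `mi`, i.e. the power gains are Gamma distributed with these shapes and mean `1`.
The marks of different nodes are independent of each other, and all marks are independent of the
locations. The mode, the resource block and the fading of a node are mutually independent, and the
mode of the typical node is independent of everything else. The two gains `h j` and `g j` of one
node may depend on each other in any way (they may be equal if `ms = mi`). -/
structure IsNakagamiModel [MeasurableSpace Ω] (P : Measure Ω) (lam : ℝ≥0) (ρ : ℝ) (ms mi : ℕ)
    (N : HelloNetwork Ω M) : Prop where
  ppp : IsHomogeneousPPP P lam N.X
  measurable_Z₀ : Measurable N.Z₀
  measurable_mark : ∀ j, Measurable (N.mark j)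
  law_Z₀ : P {ω | N.Z₀ ω = true} = ENNReal.ofReal ρ
  law_Z : ∀ j, P {ω | N.Z j ω = true} = ENNReal.ofReal ρ
  law_B : ∀ j b, P {ω | N.B j ω = b} = (M : ℝ≥0∞)⁻¹
  law_h : ∀ j, P.map (N.h j) = gammaMeasure ms ms
  law_g : ∀ j, P.map (N.g j) = gammaMeasure mi mi
  indep_Z : ∀ j, IndepFun (N.Z j) (fun ω => (N.B j ω, N.h j ω, N.g j ω)) P
  indep_B : ∀ j, IndepFun (N.B j) (fun ω => (N.h j ω, N.g j ω)) P
  indep_mark : iIndepFun N.mark P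
  indep_X : IndepFun (fun ω j => N.X j ω) (fun ω j => N.mark j ω) P
  indep_Z₀ : IndepFun N.Z₀ (fun ω => (fun j => N.X j ω, fun j => N.mark j ω)) P

end HelloNetwork

/-- `Δ_s(m, α) = m^(-2/α) Γ(m + 2/α) / (Γ(1 + 2/α) Γ(m))` -/
noncomputable def deltaS (m : ℕ) (α : ℝ) : ℝ :=
  (m : ℝ) ^ (-(2 / α)) *
    (Real.Gamma (m + 2 / α) / (Real.Gamma (1 + 2 / α) * Real.Gamma m))

/-- `Δ_i(m, α) = m^(-2/α) Γ(1 - 2/α) Γ(m + 2/α) / Γ(m)` -/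
noncomputable def deltaI (m : ℕ) (α : ℝ) : ℝ :=
  (m : ℝ) ^ (-(2 / α)) *
    (Real.Gamma (1 - 2 / α) * Real.Gamma (m + 2 / α) / Real.Gamma m)

/-! Write δ = 2/α, q = ρ/M, and I for the total power on one resource block. The typical node
receives with probability 1 - ρ, independently of everything else. So it suffices to compute, for
each block, the mean number of nodes that transmit there and satisfy ‖X‖^(-α) h > ξ I', where I' is
the interference from the other nodes on the block.

By a Mecke equation, the transmitters on a block, listed with location, desired gain and I', have
intensity λ q dx ⊗ law(h) ⊗ law(I) (`sum_map_onBlock`). For given h and I the admissible locations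
fill a disc of area π h^δ (ξ I)^(-δ) (`volume_lt_pathLoss`), so the mean per block is λ q π ξ^(-δ)
E[h^δ] E[I^(-δ)]. Here E[h^δ] = Δ_s Γ(1+δ). The Laplace transform of I is exp(-c s^δ) with c = λ q π
Δ_i (`lintegral_expNeg_blockTotal`, `lintegral_lossAt`); integrating it against s^(δ-1) gives
E[I^(-δ)] = 1/(Γ(1+δ) c) (`lintegral_blockTotal_rpow`). Everything except Δ_s/(Δ_i ξ^δ) cancels. For
equal shapes Euler's reflection formula turns the ratio into the sine.

The Poisson hypothesis concerns only counts in sets. It yields the Laplace functional, and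
differentiating that along an indicator yields Mecke's equation for exponentials of sums over the
process. Marks are averaged out with the locations fixed, and equality of Laplace transforms becomes
equality of measures by `measure_ext_of_lintegral_expNeg`. Working in [0, ∞] avoids any prior proof
that the interference is finite or positive. -/

/-! ### Exponential and logarithm on [0, ∞]. -/

/-- The function `x ↦ exp (-x)` on `[0, ∞]`, with value `0` at `∞`. -/
noncomputable def expNeg (x : ℝ≥0∞) : ℝ≥0∞ := EReal.exp (-(x : EReal))

/-- The function `w ↦ -log w` on `[0, 1]`, with value `∞` at `0`. -/
noncomputable def negLog (w : ℝ≥0∞) : ℝ≥0∞ := (-(ENNReal.log w)).toENNReal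

@[simp] lemma expNeg_zero : expNeg 0 = 1 := by simp [expNeg]

@[simp] lemma expNeg_top : expNeg ∞ = 0 := by simp [expNeg]

lemma expNeg_ofReal {r : ℝ} (hr : 0 ≤ r) :
    expNeg (ENNReal.ofReal r) = ENNReal.ofReal (Real.exp (-r)) := by
  rw [expNeg, EReal.coe_ennreal_ofReal, max_eq_left hr, ← EReal.coe_neg, EReal.exp_coe]

lemma continuous_expNeg : Continuous expNeg :=
  ENNReal.continuous_exp.comp (continuous_neg.comp continuous_coe_ennreal_ereal)

lemma measurable_expNeg : Measurable expNeg := continuous_expNeg.measurable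

@[fun_prop]
lemma Measurable.expNeg {β : Type*} [MeasurableSpace β] {f : β → ℝ≥0∞} (hf : Measurable f) :
    Measurable fun x => expNeg (f x) := measurable_expNeg.comp hf

lemma expNeg_strictAnti : StrictAnti expNeg := fun _ _ h =>
  EReal.exp_strictMono (EReal.neg_lt_neg_iff.2 (EReal.coe_ennreal_lt_coe_ennreal_iff.2 h))

lemma expNeg_le_one (x : ℝ≥0∞) : expNeg x ≤ 1 := by
  simpa using expNeg_strictAnti.antitone zero_le

lemma expNeg_ne_top (x : ℝ≥0∞) : expNeg x ≠ ∞ :=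
  ((expNeg_le_one x).trans_lt ENNReal.one_lt_top).ne

lemma expNeg_add (x y : ℝ≥0∞) : expNeg (x + y) = expNeg x * expNeg y := by
  rw [expNeg, expNeg, expNeg, ← EReal.exp_add, EReal.coe_ennreal_add, EReal.neg_add]
  · rw [sub_eq_add_neg]
  · left; exact EReal.coe_ennreal_ne_bot x
  · right; exact EReal.coe_ennreal_ne_bot y

lemma expNeg_sum {ι : Type*} (s : Finset ι) (f : ι → ℝ≥0∞) :
    expNeg (∑ i ∈ s, f i) = ∏ i ∈ s, expNeg (f i) := by
  classical
  induction s using Finset.induction_on with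
  | empty => simp
  | insert a s ha ih => rw [Finset.sum_insert ha, Finset.prod_insert ha, expNeg_add, ih]

lemma expNeg_nat_mul (n : ℕ) (x : ℝ≥0∞) : expNeg (n * x) = expNeg x ^ n := by
  induction n with
  | zero => simp
  | succ k ih => rw [Nat.cast_succ, add_mul, one_mul, expNeg_add, ih, pow_succ]

lemma expNeg_pos {x : ℝ≥0∞} (hx : x ≠ ∞) : 0 < expNeg x := by
  simpa using expNeg_strictAnti (lt_top_iff_ne_top.2 hx)

lemma expNeg_negLog {w : ℝ≥0∞} (hw : w ≤ 1) : expNeg (negLog w) = w := by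
  have : 0 ≤ -(ENNReal.log w) := by
    rw [EReal.neg_nonneg]
    simpa using hw
  rw [expNeg, negLog, EReal.coe_toENNReal this, neg_neg, ENNReal.exp_log]

@[fun_prop]
lemma Measurable.negLog {β : Type*} [MeasurableSpace β] {f : β → ℝ≥0∞} (hf : Measurable f) :
    Measurable fun x => negLog (f x) :=
  (measurable_ereal_toENNReal.comp measurable_neg).comp hf.ennreal_log

lemma negLog_ne_top {w : ℝ≥0∞} (hw : w ≤ 1) (h0 : w ≠ 0) : negLog w ≠ ∞ := by
  intro h
  have := expNeg_negLog hw
  rw [h, expNeg_top] at this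
  exact h0 this.symm

lemma tendsto_expNeg_sum_range (f : ℕ → ℝ≥0∞) :
    Filter.Tendsto (fun n => ∏ i ∈ Finset.range n, expNeg (f i)) Filter.atTop
      (nhds (expNeg (∑' i, f i))) := by
  simp_rw [← expNeg_sum]
  exact (continuous_expNeg.tendsto _).comp (ENNReal.tendsto_nat_tsum f)

lemma one_sub_expNeg_ofReal {r : ℝ} (hr : 0 ≤ r) :
    1 - expNeg (ENNReal.ofReal r) = ENNReal.ofReal (1 - Real.exp (-r)) := by
  rw [expNeg_ofReal hr, ← ENNReal.ofReal_one, ENNReal.ofReal_sub _ (Real.exp_pos _).le]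

lemma one_sub_expNeg_le (x : ℝ≥0∞) : 1 - expNeg x ≤ x := by
  induction x with
  | top => simp
  | coe x =>
    rw [← ENNReal.ofReal_coe_nnreal, one_sub_expNeg_ofReal x.coe_nonneg]
    apply ENNReal.ofReal_le_ofReal
    have := Real.add_one_le_exp (-(x : ℝ))
    linarith

-- This is the derivative at 0 of the composite exponential. It evaluates the right side when the
-- Laplace functional is differentiated in `lintegral_expNeg_tsum_mul_pointCount`.
open Filter Topology in
lemma tendsto_inv_mul_one_sub_expNeg_one_sub_expNeg {m : ℝ≥0∞} (hm : m ≠ ∞) :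
    Tendsto (fun ε : ℝ => ENNReal.ofReal ε⁻¹ *
      (1 - expNeg (m * (1 - expNeg (ENNReal.ofReal ε))))) (𝓝[>] 0) (𝓝 m) := by
  lift m to ℝ≥0 using hm
  have hd : HasDerivAt (fun t : ℝ => 1 - Real.exp (-(m * (1 - Real.exp (-t))))) (m : ℝ) 0 := by
    have h1 : HasDerivAt (fun t : ℝ => Real.exp (-t)) (-1) 0 := by
      simpa using (hasDerivAt_neg (0 : ℝ)).exp
    have h2 := (((h1.const_sub 1).const_mul (m : ℝ)).neg.exp).const_sub 1
    simpa using h2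
  have ht := (ENNReal.continuous_ofReal.tendsto _).comp hd.tendsto_slope_zero_right
  rw [← ENNReal.ofReal_coe_nnreal]
  refine ht.congr' ?_
  filter_upwards [self_mem_nhdsWithin] with ε hε
  have hε : 0 < ε := hε
  have h1 : 0 ≤ 1 - Real.exp (-ε) := by
    simpa using hε.le
  rw [one_sub_expNeg_ofReal hε.le, ← ENNReal.ofReal_mul m.coe_nonneg, one_sub_expNeg_ofReal (by positivity),
    ← ENNReal.ofReal_mul (by positivity)]
  simp

open Filter Topology in
lemma tendsto_inv_mul_one_sub_expNeg (y : ℝ≥0∞) :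
    Tendsto (fun ε : ℝ => ENNReal.ofReal ε⁻¹ * (1 - expNeg (ENNReal.ofReal ε * y)))
      (𝓝[>] 0) (𝓝 y) := by
  induction y with
  | top =>
    have : Tendsto (fun ε : ℝ => ENNReal.ofReal ε⁻¹) (𝓝[>] 0) (𝓝 ∞) :=
      ENNReal.tendsto_ofReal_atTop.comp tendsto_inv_nhdsGT_zero
    refine this.congr' ?_
    filter_upwards [self_mem_nhdsWithin] with ε hε
    have hε : 0 < ε := hε
    simp [ENNReal.mul_top, hε]
  | coe y =>
    have hd : HasDerivAt (fun t : ℝ => 1 - Real.exp (-(t * y))) (y : ℝ) 0 := by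
      have h2 := (((hasDerivAt_id (0 : ℝ)).mul_const (y : ℝ)).neg.exp).const_sub 1
      simpa using h2
    have ht := (ENNReal.continuous_ofReal.tendsto _).comp hd.tendsto_slope_zero_right
    rw [← ENNReal.ofReal_coe_nnreal]
    refine ht.congr' ?_
    filter_upwards [self_mem_nhdsWithin] with ε hε
    have hε : 0 < ε := hε
    rw [← ENNReal.ofReal_mul hε.le, one_sub_expNeg_ofReal (by positivity),
      ← ENNReal.ofReal_mul (by positivity)]
    simp

/-! ### Poisson counts and the Laplace functional. -/

/-- The Poisson generating function evaluated at e^(-c); the value c = ∞ is allowed and picks out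
the event that the count is 0. -/
lemma lintegral_expNeg_poissonMeasure (r : ℝ≥0) (c : ℝ≥0∞) :
    ∫⁻ n : ℕ, expNeg (c * n) ∂(poissonMeasure r) = expNeg (r * (1 - expNeg c)) := by
  obtain ⟨q, hq⟩ : ∃ q : ℝ≥0, expNeg c = q := ⟨_, (ENNReal.coe_toNNReal (expNeg_ne_top c)).symm⟩
  have hq1 : (q : ℝ) ≤ 1 := by
    have := expNeg_le_one c
    rw [hq] at this
    exact_mod_cast this
  have h1 : ∀ n : ℕ, ENNReal.ofReal (Real.exp (-r) * r ^ n / (n.factorial)) * expNeg (c * n) =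
      ENNReal.ofReal (Real.exp (-r) * ((r * q) ^ n / (n.factorial))) := by
    intro n
    rw [mul_comm c, expNeg_nat_mul, hq, ← ENNReal.coe_pow, ← ENNReal.ofReal_coe_nnreal,
      ← ENNReal.ofReal_mul (by positivity)]
    congr 1
    push_cast
    ring
  have hs : HasSum (fun n : ℕ => Real.exp (-r) * (((r : ℝ) * q) ^ n / (n.factorial)))
      (Real.exp (-r) * Real.exp (r * q)) := by
    rw [Real.exp_eq_exp_ℝ]
    exact (NormedSpace.expSeries_div_hasSum_exp ((r : ℝ) * q)).mul_left _
  rw [poissonMeasure, lintegral_sum_measure]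
  simp_rw [lintegral_smul_measure, lintegral_dirac, smul_eq_mul, h1]
  rw [← ENNReal.ofReal_tsum_of_nonneg (fun n => by positivity) hs.summable, hs.tsum_eq, hq,
    ← ENNReal.ofReal_coe_nnreal (p := q), ← ENNReal.ofReal_one,
    ← ENNReal.ofReal_sub _ q.coe_nonneg, ← ENNReal.ofReal_coe_nnreal (p := r), ← ENNReal.ofReal_mul r.coe_nonneg,
    expNeg_ofReal (mul_nonneg r.coe_nonneg (by linarith)), ← Real.exp_add]
  congr 2
  ring

lemma lintegral_id_poissonMeasure (r : ℝ≥0) :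
    ∫⁻ n : ℕ, (n : ℝ≥0∞) ∂(poissonMeasure r) = r := by
  rw [poissonMeasure, lintegral_sum_measure]
  simp_rw [lintegral_smul_measure, lintegral_dirac, smul_eq_mul]
  rw [tsum_eq_zero_add' ENNReal.summable]
  have h1 : ∀ n : ℕ, ENNReal.ofReal (Real.exp (-r) * r ^ (n + 1) / ((n + 1).factorial)) *
      ((n + 1 : ℕ) : ℝ≥0∞) = r * ENNReal.ofReal (Real.exp (-r) * r ^ n / (n.factorial)) := by
    intro n
    rw [← ENNReal.ofReal_natCast, ← ENNReal.ofReal_mul (by positivity),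
      ← ENNReal.ofReal_coe_nnreal (p := r), ← ENNReal.ofReal_mul r.coe_nonneg]
    congr 1
    rw [Nat.factorial_succ]
    push_cast
    field_simp
    ring
  have hs := hasSum_one_poissonMeasure r
  simp_rw [h1, ENNReal.tsum_mul_left]
  rw [← ENNReal.ofReal_tsum_of_nonneg (fun n => by positivity) hs.summable, hs.tsum_eq]
  simp

lemma encard_setOf_eq_tsum {ι : Type*} (s : Set ι) :
    ((s.encard : ℕ∞) : ℝ≥0∞) = ∑' j, s.indicator (fun _ => (1 : ℝ≥0∞)) j := by
  rw [← ENNReal.tsum_set_one, tsum_subtype s (fun _ => (1 : ℝ≥0∞))]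

lemma pointCount_eq_tsum {Ω : Type*} (X : ℕ → Ω → Plane) (A : Set Plane) (ω : Ω) :
    (pointCount X A ω : ℝ≥0∞) = ∑' j, A.indicator (fun _ => (1 : ℝ≥0∞)) (X j ω) := by
  rw [pointCount, encard_setOf_eq_tsum]
  rfl

/-- The sets are the level sets of `s` inside `K`. Since `F` is arbitrary, one decomposition serves
both the function itself and 1 - e^(-function). -/
lemma exists_disjoint_sum_indicator_simpleFunc {β : Type*} [MeasurableSpace β] (s : SimpleFunc β ℝ≥0∞)
    {K : Set β} (hK : MeasurableSet K) :
    ∃ (n : ℕ) (A : Fin n → Set β) (c : Fin n → ℝ≥0∞), (∀ k, MeasurableSet (A k)) ∧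
      (∀ k, A k ⊆ K) ∧ Pairwise (fun k l => Disjoint (A k) (A l)) ∧
      ∀ (F : ℝ≥0∞ → ℝ≥0∞), F 0 = 0 → ∀ x,
        F (K.indicator s x) = ∑ k, F (c k) * (A k).indicator (fun _ => 1) x := by
  classical
  let e := s.range.equivFin
  refine ⟨_, fun k => s ⁻¹' {(e.symm k : ℝ≥0∞)} ∩ K, fun k => (e.symm k : ℝ≥0∞),
    fun k => (s.measurableSet_preimage _).inter hK, fun k => Set.inter_subset_right, ?_, ?_⟩
  · intro k l hkl
    refine Disjoint.mono Set.inter_subset_left Set.inter_subset_left ?_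
    refine Disjoint.preimage _ ?_
    rw [Set.disjoint_singleton]
    intro h
    exact hkl (e.symm.injective (Subtype.ext h))
  · intro F hF x
    by_cases hx : x ∈ K
    · rw [Finset.sum_eq_single (e ⟨s x, s.mem_range_self x⟩)]
      · simp [hx]
      · intro k _ hk
        rw [Set.indicator_of_notMem, mul_zero]
        rintro ⟨h, -⟩
        apply hk
        rw [← e.symm.injective.eq_iff, Equiv.symm_apply_apply]
        exact Subtype.ext h.symm
      · simp
    · simp [hx, hF]

namespace IsHomogeneousPPP

variable {Ω : Type*} [MeasurableSpace Ω] {P : Measure Ω} {lam : ℝ≥0} {X : ℕ → Ω → Plane}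

lemma measurable_pointCount (hX : IsHomogeneousPPP P lam X) {A : Set Plane}
    (hA : MeasurableSet A) : Measurable (pointCount X A) := by
  refine measurable_to_countable' fun n => ?_
  have h : Measurable fun ω => (pointCount X A ω : ℝ≥0∞) := by
    simp_rw [pointCount_eq_tsum]
    exact Measurable.tsum fun j => (measurable_const.indicator hA).comp (hX.measurable j)
  have : pointCount X A ⁻¹' {n} = (fun ω => (pointCount X A ω : ℝ≥0∞)) ⁻¹' {(n : ℝ≥0∞)} := by
    ext ω
    simp
  rw [this]
  exact h (measurableSet_singleton _)

lemma lintegral_comp_pointCount (hX : IsHomogeneousPPP P lam X) {A : Set Plane}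
    (hA : MeasurableSet A) (hA' : volume A ≠ ∞) (F : ℕ∞ → ℝ≥0∞) :
    ∫⁻ ω, F (pointCount X A ω) ∂P =
      ∫⁻ n : ℕ, F n ∂(poissonMeasure (lam * (volume A).toNNReal)) := by
  rw [← lintegral_map (Measurable.of_discrete (f := F)) (hX.measurable_pointCount hA),
    hX.count_law A hA hA', lintegral_map Measurable.of_discrete Measurable.of_discrete]

lemma lintegral_expNeg_pointCount (hX : IsHomogeneousPPP P lam X) {A : Set Plane}
    (hA : MeasurableSet A) (hA' : volume A ≠ ∞) (c : ℝ≥0∞) :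
    ∫⁻ ω, expNeg (c * pointCount X A ω) ∂P = expNeg (lam * volume A * (1 - expNeg c)) := by
  rw [hX.lintegral_comp_pointCount hA hA' (fun n => expNeg (c * n))]
  simp only [ENat.toENNReal_coe]
  rw [lintegral_expNeg_poissonMeasure, ENNReal.coe_mul, ENNReal.coe_toNNReal hA']

lemma lintegral_pointCount (hX : IsHomogeneousPPP P lam X) {A : Set Plane}
    (hA : MeasurableSet A) (hA' : volume A ≠ ∞) :
    ∫⁻ ω, pointCount X A ω ∂P = lam * volume A := by
  rw [hX.lintegral_comp_pointCount hA hA' (fun n => (n : ℝ≥0∞))]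
  simp only [ENat.toENNReal_coe]
  rw [lintegral_id_poissonMeasure, ENNReal.coe_mul, ENNReal.coe_toNNReal hA']

lemma lintegral_expNeg_sum_pointCount (hX : IsHomogeneousPPP P lam X) {n : ℕ}
    {A : Fin n → Set Plane} (hA : ∀ k, MeasurableSet (A k)) (hA' : ∀ k, volume (A k) ≠ ∞)
    (hd : Pairwise (fun k l => Disjoint (A k) (A l))) (c : Fin n → ℝ≥0∞) :
    ∫⁻ ω, expNeg (∑ k, c k * pointCount X (A k) ω) ∂P =
      expNeg (∑ k, lam * volume (A k) * (1 - expNeg (c k))) := by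
  simp_rw [expNeg_sum]
  have hi := (hX.count_indep n A hA hd).comp (fun k m => expNeg (c k * m))
    (fun k => Measurable.of_discrete)
  rw [lintegral_prod_eq_prod_lintegral_of_indepFun Finset.univ
    (fun k ω => expNeg (c k * pointCount X (A k) ω)) hi
    (fun k => (Measurable.of_discrete (f := fun m : ℕ∞ => expNeg (c k * m))).comp
      (hX.measurable_pointCount (hA k)))]
  exact Finset.prod_congr rfl fun k _ => hX.lintegral_expNeg_pointCount (hA k) (hA' k) (c k)

lemma lintegral_expNeg_tsum_simpleFunc (hX : IsHomogeneousPPP P lam X)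
    (s : SimpleFunc Plane ℝ≥0∞) {K : Set Plane} (hK : MeasurableSet K) (hK' : volume K ≠ ∞) :
    ∫⁻ ω, expNeg (∑' j, K.indicator s (X j ω)) ∂P =
      expNeg (lam * ∫⁻ x, (1 - expNeg (K.indicator s x))) := by
  obtain ⟨n, A, c, hA, hAK, hd, hF⟩ := exists_disjoint_sum_indicator_simpleFunc s hK
  have h1 : ∀ ω, ∑' j, K.indicator s (X j ω) = ∑ k, c k * pointCount X (A k) ω := by
    intro ω
    simp_rw [pointCount_eq_tsum, ← ENNReal.tsum_mul_left]
    rw [← Summable.tsum_finsetSum fun k _ => ENNReal.summable]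
    exact tsum_congr fun j => hF id rfl (X j ω)
  have h2 : ∫⁻ x, (1 - expNeg (K.indicator s x)) = ∑ k, (1 - expNeg (c k)) * volume (A k) := by
    simp_rw [hF (fun y => 1 - expNeg y) (by simp)]
    rw [lintegral_finsetSum _ fun k _ =>
      (measurable_const.indicator (hA k)).const_mul _]
    refine Finset.sum_congr rfl fun k _ => ?_
    rw [lintegral_const_mul _ (measurable_const.indicator (hA k)), lintegral_indicator_const (hA k),
      one_mul]
  simp_rw [h1]
  rw [hX.lintegral_expNeg_sum_pointCount hA
    (fun k => ((measure_mono (hAK k)).trans_lt (lt_top_iff_ne_top.2 hK')).ne) hd, h2,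
    Finset.mul_sum]
  congr 1
  exact Finset.sum_congr rfl fun k _ => by ring

open Filter Topology in
/-- The Laplace functional of a homogeneous Poisson point process. -/
theorem lintegral_expNeg_tsum [IsProbabilityMeasure P] (hX : IsHomogeneousPPP P lam X)
    {l : Plane → ℝ≥0∞} (hl : Measurable l) :
    ∫⁻ ω, expNeg (∑' j, l (X j ω)) ∂P = expNeg (lam * ∫⁻ x, (1 - expNeg (l x))) := by
  let K : ℕ → Set Plane := fun n => Metric.ball 0 n
  -- Cutting off to balls makes all level sets finite in area, so that the count laws apply; the
  -- approximations still increase to `l`.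
  let f : ℕ → Plane → ℝ≥0∞ := fun n => (K n).indicator (SimpleFunc.eapprox l n)
  have hK : ∀ n, MeasurableSet (K n) := fun n => Metric.isOpen_ball.measurableSet
  have hfm : ∀ n, Measurable (f n) := fun n => (SimpleFunc.measurable _).indicator (hK n)
  have hmono : ∀ x, Monotone fun n => f n x := by
    intro x n m hnm
    refine (Set.indicator_le_indicator (SimpleFunc.monotone_eapprox l hnm x)).trans ?_
    exact Set.indicator_le_indicator_of_subset
      (Metric.ball_subset_ball (by exact_mod_cast hnm)) (fun _ => zero_le) x
  have hlim : ∀ x, Tendsto (fun n => f n x) atTop (𝓝 (l x)) := by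
    intro x
    refine (SimpleFunc.tendsto_eapprox hl x).congr' ?_
    filter_upwards [eventually_gt_atTop ⌈‖x‖⌉₊] with n hn
    have : x ∈ K n := by
      rw [mem_ball_zero_iff]
      exact (Nat.le_ceil _).trans_lt (by exact_mod_cast hn)
    simp [f, this]
  have hsum : ∀ ω, Tendsto (fun n => ∑' j, f n (X j ω)) atTop (𝓝 (∑' j, l (X j ω))) := by
    intro ω
    simp_rw [← lintegral_count]
    exact lintegral_tendsto_of_tendsto_of_monotone (fun n => Measurable.of_discrete.aemeasurable)
      (ae_of_all _ fun j => hmono _) (ae_of_all _ fun j => hlim _)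
  have hL : Tendsto (fun n => ∫⁻ ω, expNeg (∑' j, f n (X j ω)) ∂P) atTop
      (𝓝 (∫⁻ ω, expNeg (∑' j, l (X j ω)) ∂P)) := by
    refine tendsto_lintegral_of_dominated_convergence (fun _ => 1) (fun n => ?_)
      (fun n => ae_of_all _ fun ω => expNeg_le_one _) (by simp)
      (ae_of_all _ fun ω => (continuous_expNeg.tendsto _).comp (hsum ω))
    exact (Measurable.tsum fun j => (hfm n).comp (hX.measurable j)).expNeg
  have hI : Tendsto (fun n => ∫⁻ x, (1 - expNeg (f n x))) atTop
      (𝓝 (∫⁻ x, (1 - expNeg (l x)))) := by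
    refine lintegral_tendsto_of_tendsto_of_monotone
      (fun n => (measurable_const.sub (hfm n).expNeg).aemeasurable)
      (ae_of_all _ fun x n m hnm =>
        tsub_le_tsub_left (expNeg_strictAnti.antitone (hmono x hnm)) 1)
      (ae_of_all _ fun x => ?_)
    exact ENNReal.Tendsto.sub tendsto_const_nhds ((continuous_expNeg.tendsto _).comp (hlim x))
      (Or.inl ENNReal.one_ne_top)
  have hR := (continuous_expNeg.tendsto _).comp
    (ENNReal.Tendsto.const_mul hI (Or.inr (ENNReal.coe_ne_top (r := lam))))
  refine tendsto_nhds_unique hL (hR.congr fun n => ?_)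
  exact (hX.lintegral_expNeg_tsum_simpleFunc _ (hK n) measure_ball_lt_top.ne).symm

end IsHomogeneousPPP

/-! ### Mecke's equation by differentiating the Laplace functional. -/

namespace IsHomogeneousPPP

variable {Ω : Type*} [MeasurableSpace Ω] {P : Measure Ω} {lam : ℝ≥0} {X : ℕ → Ω → Plane}

-- Take the Laplace functional at l + ε·1_A and differentiate at ε = 0: on the left this brings down
-- the count in A, on the right the integral of e^(-l) over A.
open Filter Topology in
lemma lintegral_expNeg_tsum_mul_pointCount [IsProbabilityMeasure P]
    (hX : IsHomogeneousPPP P lam X) {l : Plane → ℝ≥0∞} (hl : Measurable l) {A : Set Plane}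
    (hA : MeasurableSet A) (hA' : volume A ≠ ∞) :
    ∫⁻ ω, expNeg (∑' j, l (X j ω)) * pointCount X A ω ∂P =
      expNeg (lam * ∫⁻ x, (1 - expNeg (l x))) * (lam * ∫⁻ x in A, expNeg (l x)) := by
  set C := expNeg (lam * ∫⁻ x, (1 - expNeg (l x))) with hC
  set m := lam * ∫⁻ x in A, expNeg (l x) with hm
  have hmfin : m ≠ ∞ := by
    refine ENNReal.mul_ne_top ENNReal.coe_ne_top (ne_top_of_le_ne_top hA' ?_)
    refine (lintegral_mono fun x => expNeg_le_one (l x)).trans ?_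
    simp
  have hLm : Measurable fun ω => expNeg (∑' j, l (X j ω)) :=
    (Measurable.tsum fun j => hl.comp (hX.measurable j)).expNeg
  have hNm : Measurable fun ω => (pointCount X A ω : ℝ≥0∞) :=
    Measurable.of_discrete.comp (hX.measurable_pointCount hA)
  have h1 : ∀ ε : ℝ, ∫⁻ ω, expNeg (∑' j, l (X j ω)) * expNeg (ENNReal.ofReal ε * pointCount X A ω) ∂P
      = C * expNeg (m * (1 - expNeg (ENNReal.ofReal ε))) := by
    intro ε
    set c := ENNReal.ofReal ε
    have e1 : ∀ ω, expNeg (∑' j, l (X j ω)) * expNeg (c * pointCount X A ω) =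
        expNeg (∑' j, (l (X j ω) + A.indicator (fun _ => c) (X j ω))) := by
      intro ω
      rw [ENNReal.tsum_add, expNeg_add, pointCount_eq_tsum, ← ENNReal.tsum_mul_left]
      congr 3
      ext j
      by_cases h : X j ω ∈ A <;> simp [h]
    have e2 : ∀ x, 1 - expNeg (l x + A.indicator (fun _ => c) x) =
        (1 - expNeg (l x)) + A.indicator (fun x => expNeg (l x) * (1 - expNeg c)) x := by
      intro x
      by_cases h : x ∈ A
      · simp only [h, Set.indicator_of_mem, expNeg_add]
        rw [ENNReal.mul_sub (fun _ _ => expNeg_ne_top _), mul_one,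
          tsub_add_tsub_cancel (expNeg_le_one _)]
        exact mul_le_of_le_one_right' (expNeg_le_one c)
      · simp [h]
    simp_rw [e1]
    rw [hX.lintegral_expNeg_tsum (hl.fun_add (measurable_const.indicator hA))]
    simp_rw [e2]
    rw [lintegral_add_left (measurable_const.fun_sub hl.expNeg), lintegral_indicator hA,
      lintegral_mul_const _ hl.expNeg, mul_add, expNeg_add, hC, hm, mul_assoc]
  have h2 : ∀ ε : ℝ, ∫⁻ ω, expNeg (∑' j, l (X j ω)) *
      (ENNReal.ofReal ε⁻¹ * (1 - expNeg (ENNReal.ofReal ε * pointCount X A ω))) ∂P =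
      C * (ENNReal.ofReal ε⁻¹ * (1 - expNeg (m * (1 - expNeg (ENNReal.ofReal ε))))) := by
    intro ε
    have hC' : C = ∫⁻ ω, expNeg (∑' j, l (X j ω)) ∂P := (hX.lintegral_expNeg_tsum hl).symm
    have e3 : ∀ ω, expNeg (∑' j, l (X j ω)) *
      (ENNReal.ofReal ε⁻¹ * (1 - expNeg (ENNReal.ofReal ε * pointCount X A ω))) =
      ENNReal.ofReal ε⁻¹ * (expNeg (∑' j, l (X j ω)) -
        expNeg (∑' j, l (X j ω)) * expNeg (ENNReal.ofReal ε * pointCount X A ω)) := by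
      intro ω
      rw [mul_left_comm, ENNReal.mul_sub (fun _ _ => expNeg_ne_top _), mul_one]
    have hm1 : Measurable fun ω => expNeg (∑' j, l (X j ω)) *
        expNeg (ENNReal.ofReal ε * pointCount X A ω) := hLm.mul (hNm.const_mul _).expNeg
    simp_rw [e3]
    rw [lintegral_const_mul _ (hLm.fun_sub hm1), lintegral_sub hm1, h1, ← hC', mul_left_comm C,
      ENNReal.mul_sub (fun _ _ => expNeg_ne_top _), mul_one]
    · rw [h1]
      exact ENNReal.mul_ne_top (expNeg_ne_top _) (expNeg_ne_top _)
    · exact ae_of_all _ fun ω => mul_le_of_le_one_right' (expNeg_le_one _)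
  have hl1 : Tendsto (fun ε : ℝ => ∫⁻ ω, expNeg (∑' j, l (X j ω)) *
      (ENNReal.ofReal ε⁻¹ * (1 - expNeg (ENNReal.ofReal ε * pointCount X A ω))) ∂P) (𝓝[>] 0)
      (𝓝 (∫⁻ ω, expNeg (∑' j, l (X j ω)) * pointCount X A ω ∂P)) := by
    -- The difference quotient ε⁻¹(1 - e^(-εN)) is at most N, whose mean λ|A| is finite.
    refine tendsto_lintegral_filter_of_dominated_convergence
      (fun ω => (pointCount X A ω : ℝ≥0∞)) ?_ ?_ ?_ ?_
    · exact Eventually.of_forall fun ε =>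
        hLm.mul ((measurable_const.sub (hNm.const_mul _).expNeg).const_mul _)
    · filter_upwards [self_mem_nhdsWithin] with ε hε
      have hε : 0 < ε := hε
      refine ae_of_all _ fun ω => (mul_le_of_le_one_left' (expNeg_le_one _)).trans ?_
      refine (mul_le_mul_right (one_sub_expNeg_le _) _).trans ?_
      rw [← mul_assoc, ← ENNReal.ofReal_mul (by positivity), inv_mul_cancel₀ hε.ne']
      simp
    · rw [hX.lintegral_pointCount hA hA']
      exact ENNReal.mul_ne_top ENNReal.coe_ne_top hA'
    · exact ae_of_all _ fun ω => ENNReal.Tendsto.const_mul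
        (tendsto_inv_mul_one_sub_expNeg _) (Or.inr (expNeg_ne_top _))
  have hl2 : Tendsto (fun ε : ℝ => C * (ENNReal.ofReal ε⁻¹ *
      (1 - expNeg (m * (1 - expNeg (ENNReal.ofReal ε)))))) (𝓝[>] 0) (𝓝 (C * m)) :=
    ENNReal.Tendsto.const_mul (tendsto_inv_mul_one_sub_expNeg_one_sub_expNeg hmfin)
      (Or.inr (expNeg_ne_top _))
  simp_rw [h2] at hl1
  exact tendsto_nhds_unique hl1 hl2

/-- The preceding lemma is the case where `f` is the indicator of a set of finite area. Read as an
equality of two measures on the plane, it extends to every `f`. -/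
lemma tsum_lintegral_mul_expNeg_tsum [IsProbabilityMeasure P] (hX : IsHomogeneousPPP P lam X)
    {l f : Plane → ℝ≥0∞} (hl : Measurable l) (hf : Measurable f) :
    ∑' i, ∫⁻ ω, f (X i ω) * expNeg (∑' j, l (X j ω)) ∂P =
      expNeg (lam * ∫⁻ x, (1 - expNeg (l x))) * (lam * ∫⁻ x, f x * expNeg (l x)) := by
  set C := expNeg (lam * ∫⁻ x, (1 - expNeg (l x))) with hC
  have hLm : Measurable fun ω => expNeg (∑' j, l (X j ω)) :=
    (Measurable.tsum fun j => hl.comp (hX.measurable j)).expNeg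
  let Q : Measure Ω := P.withDensity fun ω => expNeg (∑' j, l (X j ω))
  have key : Measure.sum (fun i => Q.map (X i)) =
      (C * lam) • (volume.withDensity fun x => expNeg (l x)) := by
    have hU : (⋃ n : ℕ, Metric.ball (0 : Plane) n) = Set.univ := Metric.iUnion_ball_nat 0
    refine (Measure.ext_iff_of_iUnion_eq_univ hU).2 fun n => ?_
    ext A hA
    set B := A ∩ Metric.ball (0 : Plane) n
    have hB : MeasurableSet B := hA.inter Metric.isOpen_ball.measurableSet
    have hB' : volume B ≠ ∞ :=
      ((measure_mono Set.inter_subset_right).trans_lt measure_ball_lt_top).ne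
    rw [Measure.restrict_apply hA, Measure.restrict_apply hA, Measure.sum_apply _ hB,
      Measure.smul_apply, withDensity_apply _ hB, smul_eq_mul, mul_assoc,
      ← hX.lintegral_expNeg_tsum_mul_pointCount hl hB hB']
    simp_rw [pointCount_eq_tsum, ← ENNReal.tsum_mul_left]
    have hBm : ∀ j, Measurable fun ω => B.indicator (fun _ => (1 : ℝ≥0∞)) (X j ω) :=
      fun j => (measurable_const.indicator hB).comp (hX.measurable j)
    rw [lintegral_tsum fun j => (hLm.fun_mul (hBm j)).aemeasurable]
    refine tsum_congr fun j => ?_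
    rw [Measure.map_apply (hX.measurable j) hB, withDensity_apply _ (hX.measurable j hB),
      ← lintegral_indicator (hX.measurable j hB)]
    refine lintegral_congr fun ω => ?_
    by_cases h : X j ω ∈ B <;> simp [h]
  have h := congrArg (fun μ => ∫⁻ x, f x ∂μ) key
  simp only [lintegral_sum_measure, lintegral_smul_measure, smul_eq_mul] at h
  rw [lintegral_withDensity_eq_lintegral_mul _ hl.expNeg hf] at h
  simp_rw [mul_comm (f _)]
  rw [← mul_assoc]
  refine Eq.trans (tsum_congr fun i => ?_) h
  rw [lintegral_map hf (hX.measurable i),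
    lintegral_withDensity_eq_lintegral_mul _ hLm (g := fun ω => f (X i ω))
      (hf.comp (hX.measurable i))]
  rfl

/-- The Mecke equation for exponentials of linear functionals of the reduced process. -/
theorem tsum_lintegral_mul_expNeg_tsum_ite [IsProbabilityMeasure P]
    (hX : IsHomogeneousPPP P lam X) {l f : Plane → ℝ≥0∞} (hl : Measurable l) (hf : Measurable f)
    (hl' : ∀ x, l x ≠ ∞) :
    ∑' i, ∫⁻ ω, f (X i ω) * expNeg (∑' j, if j = i then 0 else l (X j ω)) ∂P =
      lam * (∫⁻ x, f x) * expNeg (lam * ∫⁻ x, (1 - expNeg (l x))) := by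
  -- The test function f·e^l cancels the factor e^(-l(X i)) of the point itself; this needs `l`
  -- finite.
  have h := hX.tsum_lintegral_mul_expNeg_tsum hl
    (f := fun x => f x * (expNeg (l x))⁻¹) (hf.mul hl.expNeg.inv)
  have hc : ∀ x, (expNeg (l x))⁻¹ * expNeg (l x) = 1 := fun x =>
    ENNReal.inv_mul_cancel (expNeg_pos (hl' x)).ne' (expNeg_ne_top _)
  simp_rw [mul_assoc (f _), hc, mul_one] at h
  rw [mul_comm (lam * _ : ℝ≥0∞), ← h]
  refine tsum_congr fun i => lintegral_congr fun ω => ?_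
  rw [ENNReal.tsum_eq_add_tsum_ite (f := fun j => l (X j ω)) i, expNeg_add, ← mul_assoc _ (expNeg _),
    hc, one_mul]
  congr!

end IsHomogeneousPPP

/-! ### Uniqueness of Laplace transforms and sums of independent terms. -/

/-- A finite measure on `[0, ∞]` is determined by its Laplace transform at the naturals. -/
theorem measure_ext_of_lintegral_expNeg {μ ν : Measure ℝ≥0∞} [IsFiniteMeasure μ]
    [IsFiniteMeasure ν]
    (h : ∀ n : ℕ, ∫⁻ x, expNeg (n * x) ∂μ = ∫⁻ x, expNeg (n * x) ∂ν) : μ = ν := by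
  have hcont : Continuous fun x => (expNeg x).toReal :=
    ENNReal.continuousOn_toReal.comp_continuous continuous_expNeg fun x => expNeg_ne_top x
  let u : BoundedContinuousFunction ℝ≥0∞ ℝ :=
    BoundedContinuousFunction.mkOfCompact ⟨fun x => (expNeg x).toReal, hcont⟩
  have hu : ∀ x, u x = (expNeg x).toReal := fun x => rfl
  have hstar : ∀ g : BoundedContinuousFunction ℝ≥0∞ ℝ, star g = g := fun g => by
    ext x; simp
  -- Polynomials in u = e^(-x). They separate points because u is injective on [0, ∞], and their
  -- integrals are combinations of the given transforms.
  let A : StarSubalgebra ℝ (BoundedContinuousFunction ℝ≥0∞ ℝ) :=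
    { (Polynomial.aeval (R := ℝ) u).range with
      star_mem' := fun {g} hg => by rw [hstar g]; exact hg }
  have hint : ∀ (ρ : Measure ℝ≥0∞) [IsFiniteMeasure ρ] (n : ℕ),
      ∫ x, u x ^ n ∂ρ = (∫⁻ x, expNeg (n * x) ∂ρ).toReal := by
    intro ρ _ n
    rw [← integral_toReal]
    · refine integral_congr_ae (ae_of_all _ fun x => ?_)
      simp [hu, expNeg_nat_mul]
    · exact (measurable_id.const_mul _).expNeg.aemeasurable
    · exact ae_of_all _ fun x => (expNeg_ne_top _).lt_top
  refine ext_of_forall_mem_subalgebra_integral_eq_of_polish (𝕜 := ℝ) (A := A) ?_ ?_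
  · intro x y hxy
    refine ⟨u, ⟨BoundedContinuousFunction.toContinuousMapStarₐ ℝ u, ⟨u, ?_, rfl⟩, rfl⟩, ?_⟩
    · exact ⟨Polynomial.X, Polynomial.aeval_X u⟩
    · rw [hu, hu]
      intro hc
      exact hxy (expNeg_strictAnti.injective
        ((ENNReal.toReal_eq_toReal_iff' (expNeg_ne_top _) (expNeg_ne_top _)).1 hc))
  · rintro g ⟨p, rfl⟩
    have hev : ∀ x, (Polynomial.aeval (R := ℝ) u p) x =
        ∑ i ∈ Finset.range (p.natDegree + 1), p.coeff i * u x ^ i := by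
      intro x
      rw [Polynomial.aeval_eq_sum_range]
      simp
    have hI : ∀ (ρ : Measure ℝ≥0∞) [IsFiniteMeasure ρ],
        ∫ x, (Polynomial.aeval (R := ℝ) u p) x ∂ρ =
          ∑ i ∈ Finset.range (p.natDegree + 1),
            p.coeff i * (∫⁻ x, expNeg (i * x) ∂ρ).toReal := by
      intro ρ _
      simp_rw [hev]
      rw [integral_finsetSum]
      · refine Finset.sum_congr rfl fun i _ => ?_
        rw [integral_const_mul, hint]
      · intro i _
        exact ((u ^ i).integrable ρ).const_mul _
    refine (hI μ).trans (Eq.trans ?_ (hI ν).symm)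
    simp_rw [h]

/-- Factor the finite partial products and pass to the limit by dominated convergence. Stating the
factors as exponentials keeps the infinite product in the form of a sum, which may be ∞. -/
lemma lintegral_expNeg_tsum_of_iIndepFun {Ω : Type*} [MeasurableSpace Ω] {P : Measure Ω}
    {Y : ℕ → Ω → ℝ≥0∞} (hY : iIndepFun Y P) (hm : ∀ j, Measurable (Y j)) {y : ℕ → ℝ≥0∞}
    (hy : ∀ j, ∫⁻ ω, expNeg (Y j ω) ∂P = expNeg (y j)) :
    ∫⁻ ω, expNeg (∑' j, Y j ω) ∂P = expNeg (∑' j, y j) := by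
  have : IsProbabilityMeasure P := hY.isProbabilityMeasure
  have h1 : Filter.Tendsto (fun n => ∫⁻ ω, ∏ j ∈ Finset.range n, expNeg (Y j ω) ∂P) Filter.atTop
      (nhds (∫⁻ ω, expNeg (∑' j, Y j ω) ∂P)) := by
    refine tendsto_lintegral_of_dominated_convergence (fun _ => 1) (fun n => ?_) (fun n => ?_)
      (by simp) (ae_of_all _ fun ω => tendsto_expNeg_sum_range _)
    · exact Finset.measurable_fun_prod _ fun j _ => (hm j).expNeg
    · exact ae_of_all _ fun ω => Finset.prod_le_one' fun j _ => expNeg_le_one _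
  refine tendsto_nhds_unique h1 ((tendsto_expNeg_sum_range y).congr fun n => ?_)
  rw [lintegral_prod_eq_prod_lintegral_of_indepFun (Finset.range n) (fun j ω => expNeg (Y j ω))
    (hY.comp (fun _ => expNeg) fun _ => measurable_expNeg) fun j => (hm j).expNeg]
  exact Finset.prod_congr rfl fun j _ => (hy j).symm

/-! ### Averaging over the marks. -/

/-- The power that a node at `x` with mark `k` contributes to the resource block `b`. -/
noncomputable def blockPower {M : ℕ} (α : ℝ) (b : Fin M) (x : Plane) (k : Bool × Fin M × ℝ × ℝ) :
    ℝ≥0∞ :=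
  if k.1 = true ∧ k.2.1 = b then ENNReal.ofReal (‖x‖ ^ (-α) * k.2.2.2) else 0

lemma measurableSet_onBlock {M : ℕ} (b : Fin M) :
    MeasurableSet {k : Bool × Fin M × ℝ × ℝ | k.1 = true ∧ k.2.1 = b} :=
  (measurable_fst (measurableSet_singleton true)).inter
    ((measurable_fst.comp measurable_snd) (measurableSet_singleton b))

lemma measurable_blockPower {M : ℕ} (α : ℝ) (b : Fin M) :
    Measurable fun p : Plane × (Bool × Fin M × ℝ × ℝ) => blockPower α b p.1 p.2 := by
  refine Measurable.ite (measurable_snd (measurableSet_onBlock b)) ?_ measurable_const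
  fun_prop

/-- The mean of `1 - exp (-s P)` for the interference power `P` received from a node at `x`. -/
noncomputable def lossAt (α : ℝ) (mi : ℕ) (s : ℝ≥0∞) (x : Plane) : ℝ≥0∞ :=
  ∫⁻ g, (1 - expNeg (s * ENNReal.ofReal (‖x‖ ^ (-α) * g))) ∂(gammaMeasure mi mi)

namespace HelloNetwork

variable {Ω : Type*} [MeasurableSpace Ω] {M : ℕ} {P : Measure Ω} {lam : ℝ≥0} {ρ : ℝ} {ms mi : ℕ}
  {N : HelloNetwork Ω M}

/-- The interference power on resource block `b` from the nodes other than `i`. -/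
noncomputable def blockInterference (N : HelloNetwork Ω M) (α : ℝ) (b : Fin M) (i : ℕ) (ω : Ω) :
    ℝ≥0∞ :=
  ∑' j, if j = i then 0 else blockPower α b (N.X j ω) (N.mark j ω)

/-- The total power on resource block `b` from all nodes. -/
noncomputable def blockTotal (N : HelloNetwork Ω M) (α : ℝ) (b : Fin M) (ω : Ω) : ℝ≥0∞ :=
  ∑' j, blockPower α b (N.X j ω) (N.mark j ω)

namespace IsNakagamiModel

/-- Split off first the mode, then the block. The two gains stay together, so their dependence is
harmless. -/
lemma lintegral_onBlock (hN : N.IsNakagamiModel P lam ρ ms mi) (j : ℕ) (b : Fin M)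
    {F : ℝ × ℝ → ℝ≥0∞} (hF : Measurable F) :
    ∫⁻ ω, (if (N.mark j ω).1 = true ∧ (N.mark j ω).2.1 = b then F (N.mark j ω).2.2 else 0) ∂P =
      ENNReal.ofReal ρ * (M : ℝ≥0∞)⁻¹ * ∫⁻ ω, F (N.h j ω, N.g j ω) ∂P := by
  have hmZ : Measurable (N.Z j) := measurable_fst.comp (hN.measurable_mark j)
  have hmR : Measurable fun ω => (N.B j ω, N.h j ω, N.g j ω) :=
    measurable_snd.comp (hN.measurable_mark j)
  have hmB : Measurable (N.B j) := measurable_fst.comp hmR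
  have hmG : Measurable fun ω => (N.h j ω, N.g j ω) := measurable_snd.comp hmR
  let f₁ : Bool → ℝ≥0∞ := ({true} : Set Bool).indicator fun _ => 1
  let f₂ : Fin M → ℝ≥0∞ := ({b} : Set (Fin M)).indicator fun _ => 1
  have e : ∀ ω, (if (N.mark j ω).1 = true ∧ (N.mark j ω).2.1 = b then F (N.mark j ω).2.2 else 0) =
      f₁ (N.Z j ω) * (f₂ (N.B j ω) * F (N.h j ω, N.g j ω)) := by
    intro ω
    by_cases h1 : N.Z j ω = true <;> by_cases h2 : N.B j ω = b <;> simp [f₁, f₂, mark, h1, h2]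
  have hf₁ : Measurable f₁ := Measurable.of_discrete
  have hf₂ : Measurable f₂ := Measurable.of_discrete
  have hp : Measurable fun p : Fin M × ℝ × ℝ => f₂ p.1 * F p.2 :=
    (hf₂.comp measurable_fst).mul (hF.comp measurable_snd)
  simp_rw [e]
  rw [lintegral_mul_eq_lintegral_mul_lintegral_of_indepFun'' (f := fun ω => f₁ (N.Z j ω))
      (g := fun ω => f₂ (N.B j ω) * F (N.h j ω, N.g j ω)) (hf₁.comp hmZ).aemeasurable
      (hp.comp hmR).aemeasurable ((hN.indep_Z j).comp hf₁ hp),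
    lintegral_mul_eq_lintegral_mul_lintegral_of_indepFun'' (f := fun ω => f₂ (N.B j ω))
      (g := fun ω => F (N.h j ω, N.g j ω)) (hf₂.comp hmB).aemeasurable
      (hF.comp hmG).aemeasurable ((hN.indep_B j).comp hf₂ hF), ← mul_assoc]
  congr 2
  · rw [← hN.law_Z j]
    exact lintegral_indicator_one (hmZ (measurableSet_singleton true))
  · rw [← hN.law_B j b]
    exact lintegral_indicator_one (hmB (measurableSet_singleton b))

lemma measurable_h (hN : N.IsNakagamiModel P lam ρ ms mi) (j : ℕ) : Measurable (N.h j) :=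
  (measurable_fst.comp (measurable_snd.comp measurable_snd)).comp (hN.measurable_mark j)

lemma measurable_g (hN : N.IsNakagamiModel P lam ρ ms mi) (j : ℕ) : Measurable (N.g j) :=
  (measurable_snd.comp (measurable_snd.comp measurable_snd)).comp (hN.measurable_mark j)

lemma lintegral_expNeg_blockPower [IsProbabilityMeasure P]
    (hN : N.IsNakagamiModel P lam ρ ms mi) (α : ℝ) (b : Fin M) (s : ℝ≥0∞) (x : Plane) (j : ℕ) :
    ∫⁻ ω, expNeg (s * blockPower α b x (N.mark j ω)) ∂P =
      1 - ENNReal.ofReal ρ * (M : ℝ≥0∞)⁻¹ * lossAt α mi s x := by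
  have hF : Measurable fun p : ℝ × ℝ => 1 - expNeg (s * ENNReal.ofReal (‖x‖ ^ (-α) * p.2)) := by
    fun_prop
  have hF' : Measurable fun g : ℝ => 1 - expNeg (s * ENNReal.ofReal (‖x‖ ^ (-α) * g)) := by
    fun_prop
  have hb : Measurable fun ω => expNeg (s * blockPower α b x (N.mark j ω)) :=
    (((measurable_blockPower α b).comp
      (measurable_const.prodMk (hN.measurable_mark j))).const_mul s).expNeg
  have h1 := hN.lintegral_onBlock j b hF
  have h2 : ∫⁻ ω, (1 - expNeg (s * ENNReal.ofReal (‖x‖ ^ (-α) * N.g j ω))) ∂P =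
      lossAt α mi s x := by
    rw [lossAt, ← hN.law_g j, lintegral_map hF' (hN.measurable_g j)]
  rw [h2] at h1
  rw [← h1]
  have e : ∀ ω, (if (N.mark j ω).1 = true ∧ (N.mark j ω).2.1 = b then
      (1 - expNeg (s * ENNReal.ofReal (‖x‖ ^ (-α) * (N.mark j ω).2.2.2))) else 0) =
      1 - expNeg (s * blockPower α b x (N.mark j ω)) := by
    intro ω
    unfold blockPower
    split_ifs <;> simp
  simp_rw [e]
  have hle : ∫⁻ ω, (1 - expNeg (s * blockPower α b x (N.mark j ω))) ∂P ≤ 1 := by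
    refine (lintegral_mono fun ω => tsub_le_self).trans ?_
    simp
  have h3 := lintegral_sub (μ := P) (f := fun _ => 1) (measurable_const.fun_sub hb)
    (ne_top_of_le_ne_top ENNReal.one_ne_top hle) (ae_of_all _ fun ω => tsub_le_self)
  simp only [lintegral_const, measure_univ, mul_one] at h3
  rw [← h3]
  refine lintegral_congr fun ω => ?_
  rw [ENNReal.sub_sub_cancel ENNReal.one_ne_top (expNeg_le_one _)]

end IsNakagamiModel

end HelloNetwork

lemma isProbabilityMeasure_gammaMeasure_nat {m : ℕ} (hm : 0 < m) :
    IsProbabilityMeasure (gammaMeasure m m) :=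
  isProbabilityMeasure_gammaMeasure (by exact_mod_cast hm) (by exact_mod_cast hm)

lemma measurable_lossAt (α : ℝ) {mi : ℕ} (hmi : 0 < mi) (s : ℝ≥0∞) :
    Measurable (lossAt α mi s) := by
  have := isProbabilityMeasure_gammaMeasure_nat hmi
  refine Measurable.lintegral_prod_right' (f := fun p : Plane × ℝ =>
    1 - expNeg (s * ENNReal.ofReal (‖p.1‖ ^ (-α) * p.2))) ?_
  fun_prop

lemma lossAt_le_one (α : ℝ) {mi : ℕ} (hmi : 0 < mi) (s : ℝ≥0∞) (x : Plane) :
    lossAt α mi s x ≤ 1 := by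
  have := isProbabilityMeasure_gammaMeasure_nat hmi
  refine (lintegral_mono fun g => tsub_le_self).trans ?_
  simp

namespace HelloNetwork

variable {Ω : Type*} [MeasurableSpace Ω] {M : ℕ} {P : Measure Ω} {lam : ℝ≥0} {ρ : ℝ} {ms mi : ℕ}
  {N : HelloNetwork Ω M}

namespace IsNakagamiModel

/-- Independence of locations and marks plus Fubini: the marks may be averaged first, with the
locations frozen. -/
lemma lintegral_joint [IsProbabilityMeasure P] (hN : N.IsNakagamiModel P lam ρ ms mi)
    {Φ : (ℕ → Plane) × (ℕ → Bool × Fin M × ℝ × ℝ) → ℝ≥0∞} (hΦ : Measurable Φ) :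
    ∫⁻ ω, Φ (fun j => N.X j ω, fun j => N.mark j ω) ∂P =
      ∫⁻ ω, ∫⁻ ω', Φ (fun j => N.X j ω, fun j => N.mark j ω') ∂P ∂P := by
  have hX : Measurable fun ω j => N.X j ω := measurable_pi_lambda _ hN.ppp.measurable
  have hm : Measurable fun ω j => N.mark j ω := measurable_pi_lambda _ hN.measurable_mark
  have h := (indepFun_iff_map_prod_eq_prod_map_map hX.aemeasurable hm.aemeasurable).1 hN.indep_X
  have := Measure.isProbabilityMeasure_map (μ := P) hm.aemeasurable
  rw [← lintegral_map hΦ (hX.prodMk hm), h, lintegral_prod _ hΦ.aemeasurable,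
    lintegral_map hΦ.lintegral_prod_right' hX]
  refine lintegral_congr fun ω => ?_
  exact lintegral_map (hΦ.comp (measurable_prodMk_left (x := fun j => N.X j ω))) hm

lemma block_prob_lt_one (hρ : ρ < 1) (b : Fin M) : ENNReal.ofReal ρ * (M : ℝ≥0∞)⁻¹ < 1 := by
  refine lt_of_le_of_lt (mul_le_of_le_one_right' ?_) (ENNReal.ofReal_lt_one.2 hρ)
  rw [ENNReal.inv_le_one]
  exact_mod_cast b.pos

lemma lintegral_fixed_locations [IsProbabilityMeasure P] (hN : N.IsNakagamiModel P lam ρ ms mi)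
    (α : ℝ) (b : Fin M) (s : ℝ≥0∞) {D : Set (Plane × ℝ)} (hD : MeasurableSet D)
    (x : ℕ → Plane) (i : ℕ) :
    ∫⁻ ω, (if (N.mark i ω).1 = true ∧ (N.mark i ω).2.1 = b then
        D.indicator 1 (x i, (N.mark i ω).2.2.1) else 0) *
        expNeg (s * ∑' j, if j = i then 0 else blockPower α b (x j) (N.mark j ω)) ∂P =
      ENNReal.ofReal ρ * (M : ℝ≥0∞)⁻¹ * gammaMeasure ms ms (Prod.mk (x i) ⁻¹' D) *
        expNeg (∑' j, if j = i then 0 else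
          negLog (1 - ENNReal.ofReal ρ * (M : ℝ≥0∞)⁻¹ * lossAt α mi s (x j))) := by
  classical
  set q := ENNReal.ofReal ρ * (M : ℝ≥0∞)⁻¹ with hq
  have hDi : MeasurableSet (Prod.mk (x i) ⁻¹' D) := measurable_prodMk_left hD
  let T : Set (Bool × Fin M × ℝ × ℝ) :=
    {k | k.1 = true ∧ k.2.1 = b} ∩ {k | (x i, k.2.2.1) ∈ D}
  have hT : MeasurableSet T := (measurableSet_onBlock b).inter
    ((measurable_fst.comp (measurable_snd.comp measurable_snd)) hDi)
  -- The event of node `i` is encoded as e^(-∞·1_{Tᶜ}), so that the whole integrand is one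
  -- exponential of a sum of independent terms.
  let G : ℕ → Bool × Fin M × ℝ × ℝ → ℝ≥0∞ := fun j k =>
    if j = i then Tᶜ.indicator (fun _ => ∞) k else s * blockPower α b (x j) k
  have hG : ∀ j, Measurable (G j) := by
    intro j
    by_cases hj : j = i
    · simp only [G, hj, if_true]
      exact measurable_const.indicator hT.compl
    · simp only [G, hj, if_false]
      exact ((measurable_blockPower α b).comp measurable_prodMk_left).const_mul s
  have hGi : ∀ ω, expNeg (G i (N.mark i ω)) =
      if (N.mark i ω).1 = true ∧ (N.mark i ω).2.1 = b then
        D.indicator 1 (x i, (N.mark i ω).2.2.1) else 0 := by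
    intro ω
    by_cases h1 : (N.mark i ω).1 = true ∧ (N.mark i ω).2.1 = b <;>
      by_cases h2 : (x i, (N.mark i ω).2.2.1) ∈ D <;> simp [G, T, h1, h2]
  have e : ∀ ω, (if (N.mark i ω).1 = true ∧ (N.mark i ω).2.1 = b then
        D.indicator 1 (x i, (N.mark i ω).2.2.1) else 0) *
        expNeg (s * ∑' j, if j = i then 0 else blockPower α b (x j) (N.mark j ω)) =
      expNeg (∑' j, G j (N.mark j ω)) := by
    intro ω
    rw [ENNReal.tsum_eq_add_tsum_ite (f := fun j => G j (N.mark j ω)) i, expNeg_add, hGi,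
      ← ENNReal.tsum_mul_left]
    congr 3
    ext j
    by_cases hj : j = i <;> simp [G, hj]
  have hgi : ∫⁻ ω, expNeg (G i (N.mark i ω)) ∂P =
      q * gammaMeasure ms ms (Prod.mk (x i) ⁻¹' D) := by
    simp_rw [hGi]
    rw [hN.lintegral_onBlock i b (F := fun p => D.indicator 1 (x i, p.1))
      ((measurable_one.indicator hD).comp (measurable_const.prodMk measurable_fst)),
      ← hN.law_h i, Measure.map_apply (hN.measurable_h i) hDi, ← lintegral_indicator_one
        (hN.measurable_h i hDi)]
    rfl
  have hgi1 : q * gammaMeasure ms ms (Prod.mk (x i) ⁻¹' D) ≤ 1 := by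
    rw [← hgi]
    refine (lintegral_mono fun ω => expNeg_le_one _).trans ?_
    simp
  simp_rw [e]
  rw [lintegral_expNeg_tsum_of_iIndepFun (Y := fun j ω => G j (N.mark j ω))
    (hN.indep_mark.comp G hG)
    (fun j => (hG j).comp (hN.measurable_mark j))
    (y := fun j => if j = i then negLog (q * gammaMeasure ms ms (Prod.mk (x i) ⁻¹' D)) else
      negLog (1 - q * lossAt α mi s (x j))), ENNReal.tsum_eq_add_tsum_ite i, expNeg_add]
  · congr 1
    · simp [expNeg_negLog hgi1]
    · congr 2
      ext j
      by_cases hj : j = i <;> simp [hj]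
  · intro j
    by_cases hj : j = i
    · subst hj
      simp only [if_true, expNeg_negLog hgi1]
      exact hgi
    · simp only [hj, if_false, expNeg_negLog tsub_le_self, G]
      exact hN.lintegral_expNeg_blockPower α b s (x j) j

lemma lintegral_expNeg_blockTotal_fixed_locations [IsProbabilityMeasure P]
    (hN : N.IsNakagamiModel P lam ρ ms mi) (α : ℝ) (b : Fin M) (s : ℝ≥0∞) (x : ℕ → Plane) :
    ∫⁻ ω, expNeg (s * ∑' j, blockPower α b (x j) (N.mark j ω)) ∂P =
      expNeg (∑' j, negLog (1 - ENNReal.ofReal ρ * (M : ℝ≥0∞)⁻¹ * lossAt α mi s (x j))) := by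
  have hG : ∀ j, Measurable fun k => s * blockPower α b (x j) k := fun j =>
    ((measurable_blockPower α b).comp measurable_prodMk_left).const_mul s
  simp_rw [← ENNReal.tsum_mul_left]
  refine lintegral_expNeg_tsum_of_iIndepFun
    (hN.indep_mark.comp (fun j k => s * blockPower α b (x j) k) hG)
    (fun j => (hG j).comp (hN.measurable_mark j)) fun j => ?_
  rw [expNeg_negLog tsub_le_self]
  exact hN.lintegral_expNeg_blockPower α b s (x j) j

lemma measurable_blockPower_node (α : ℝ) (b : Fin M) (j : ℕ) :
    Measurable fun p : (ℕ → Plane) × (ℕ → Bool × Fin M × ℝ × ℝ) =>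
      blockPower α b (p.1 j) (p.2 j) :=
  (measurable_blockPower α b).comp
    (f := fun p : (ℕ → Plane) × (ℕ → Bool × Fin M × ℝ × ℝ) => (p.1 j, p.2 j))
    (((measurable_pi_apply j).comp measurable_fst).prodMk
      ((measurable_pi_apply j).comp measurable_snd))

/-- With l = -log(1 - q·loss), the averaged marks act as a deterministic weight on the locations,
and the integrand 1 - e^(-l) of the Laplace functional is just q·loss. -/
lemma one_sub_one_sub_loss (hmi : 0 < mi) (hρ : ρ < 1) (α : ℝ)
    (b : Fin M) (s : ℝ≥0∞) (x : Plane) :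
    1 - expNeg (negLog (1 - ENNReal.ofReal ρ * (M : ℝ≥0∞)⁻¹ * lossAt α mi s x)) =
      ENNReal.ofReal ρ * (M : ℝ≥0∞)⁻¹ * lossAt α mi s x := by
  rw [expNeg_negLog tsub_le_self, ENNReal.sub_sub_cancel ENNReal.one_ne_top]
  exact mul_le_one' (block_prob_lt_one hρ b).le (lossAt_le_one α hmi s x)

/-- The Laplace transform of the total power on a resource block. -/
lemma lintegral_expNeg_blockTotal [IsProbabilityMeasure P]
    (hN : N.IsNakagamiModel P lam ρ ms mi) (hmi : 0 < mi) (hρ : ρ < 1) (α : ℝ) (b : Fin M)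
    (s : ℝ≥0∞) :
    ∫⁻ ω, expNeg (s * N.blockTotal α b ω) ∂P =
      expNeg (lam * (ENNReal.ofReal ρ * (M : ℝ≥0∞)⁻¹ * ∫⁻ x, lossAt α mi s x)) := by
  have hΦ : Measurable fun p : (ℕ → Plane) × (ℕ → Bool × Fin M × ℝ × ℝ) =>
      expNeg (s * ∑' j, blockPower α b (p.1 j) (p.2 j)) :=
    ((Measurable.tsum fun j => measurable_blockPower_node α b j).const_mul s).expNeg
  have hl : Measurable fun x =>
      negLog (1 - ENNReal.ofReal ρ * (M : ℝ≥0∞)⁻¹ * lossAt α mi s x) :=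
    (measurable_const.fun_sub ((measurable_lossAt α hmi s).const_mul _)).negLog
  have h := hN.lintegral_joint hΦ
  simp only [hN.lintegral_expNeg_blockTotal_fixed_locations] at h
  refine h.trans ?_
  rw [hN.ppp.lintegral_expNeg_tsum hl]
  simp_rw [one_sub_one_sub_loss hmi hρ α b s]
  rw [lintegral_const_mul _ (measurable_lossAt α hmi s)]

/-- Once the marks are averaged out, this is Mecke's equation on the locations; its exponential
factor is the transform of the total power. -/
lemma tsum_lintegral_expNeg_blockInterference [IsProbabilityMeasure P]
    (hN : N.IsNakagamiModel P lam ρ ms mi) (hms : 0 < ms) (hmi : 0 < mi) (hρ : ρ < 1) (α : ℝ)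
    (b : Fin M) (s : ℝ≥0∞) {D : Set (Plane × ℝ)} (hD : MeasurableSet D) :
    ∑' i, ∫⁻ ω, (if (N.mark i ω).1 = true ∧ (N.mark i ω).2.1 = b then
        D.indicator 1 (N.X i ω, (N.mark i ω).2.2.1) else 0) *
        expNeg (s * N.blockInterference α b i ω) ∂P =
      lam * (ENNReal.ofReal ρ * (M : ℝ≥0∞)⁻¹ *
          ((volume : Measure Plane).prod (gammaMeasure ms ms)) D) *
        ∫⁻ ω, expNeg (s * N.blockTotal α b ω) ∂P := by
  have := isProbabilityMeasure_gammaMeasure_nat hms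
  set q := ENNReal.ofReal ρ * (M : ℝ≥0∞)⁻¹ with hq
  have hl : Measurable fun x => negLog (1 - q * lossAt α mi s x) :=
    (measurable_const.fun_sub ((measurable_lossAt α hmi s).const_mul _)).negLog
  -- The finiteness required by Mecke's equation comes from q < 1, hence from ρ < 1.
  have hl' : ∀ x, negLog (1 - q * lossAt α mi s x) ≠ ∞ := by
    intro x
    refine negLog_ne_top tsub_le_self (tsub_pos_of_lt ?_).ne'
    exact (mul_le_of_le_one_right' (lossAt_le_one α hmi s x)).trans_lt (block_prob_lt_one hρ b)
  have hf : Measurable fun x : Plane => gammaMeasure ms ms (Prod.mk x ⁻¹' D) :=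
    measurable_measure_prodMk_left hD
  have hmecke := hN.ppp.tsum_lintegral_mul_expNeg_tsum_ite hl (hf.const_mul q) hl'
  simp_rw [hq, one_sub_one_sub_loss hmi hρ α b s] at hmecke
  rw [lintegral_const_mul _ (measurable_lossAt α hmi s), ← hN.lintegral_expNeg_blockTotal hmi hρ,
    lintegral_const_mul _ hf, ← Measure.prod_apply hD] at hmecke
  rw [← hmecke]
  refine tsum_congr fun i => ?_
  have hΦ : Measurable fun p : (ℕ → Plane) × (ℕ → Bool × Fin M × ℝ × ℝ) =>
      (if (p.2 i).1 = true ∧ (p.2 i).2.1 = b then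
        D.indicator (1 : Plane × ℝ → ℝ≥0∞) (p.1 i, (p.2 i).2.2.1) else 0) *
      expNeg (s * ∑' j, if j = i then 0 else blockPower α b (p.1 j) (p.2 j)) := by
    have h2 : Measurable fun p : (ℕ → Plane) × (ℕ → Bool × Fin M × ℝ × ℝ) => p.2 i :=
      (measurable_pi_apply i).comp measurable_snd
    have h1 : Measurable fun p : (ℕ → Plane) × (ℕ → Bool × Fin M × ℝ × ℝ) => p.1 i :=
      (measurable_pi_apply i).comp measurable_fst
    refine Measurable.mul (Measurable.ite (h2 (measurableSet_onBlock b)) ?_ measurable_const) ?_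
    · exact (measurable_one.indicator hD).comp (h1.prodMk h2.snd.snd.fst)
    · refine ((Measurable.tsum fun j => ?_).const_mul s).expNeg
      by_cases hj : j = i
      · simp [hj]
      · simpa [hj] using measurable_blockPower_node α b j
  exact (hN.lintegral_joint hΦ).trans (lintegral_congr fun ω =>
    hN.lintegral_fixed_locations α b s hD (fun j => N.X j ω) i)

end IsNakagamiModel

end HelloNetwork

/-! ### Explicit integrals: path loss, Gamma moments, stable transforms. -/

/-- A Bochner integral with nonzero value certifies integrability, since it defaults to 0 otherwise.
-/
lemma setLIntegral_ofReal_eq_of_setIntegral_eq {s : Set ℝ} (hs : MeasurableSet s) {f : ℝ → ℝ}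
    (hf : ∀ x ∈ s, 0 ≤ f x) {c : ℝ} (hc : c ≠ 0) (h : ∫ x in s, f x = c) :
    ∫⁻ x in s, ENNReal.ofReal (f x) = ENNReal.ofReal c := by
  rw [← h, ofReal_integral_eq_lintegral_ofReal (Integrable.of_integral_ne_zero (h ▸ hc))]
  exact (ae_restrict_iff' hs).2 (ae_of_all _ hf)

/-- For 0 < t < ∞ the set is a punctured disc of radius (k/t)^(1/α). The origin drops out because
0^(-α) is 0 by convention. -/
lemma volume_lt_pathLoss {α : ℝ} (hα : 2 < α) {k : ℝ} (hk : 0 < k) (t : ℝ≥0∞) :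
    volume {x : Plane | t < ENNReal.ofReal (‖x‖ ^ (-α) * k)} =
      ENNReal.ofReal (Real.pi * k ^ (2 / α)) * t ^ (-(2 / α)) := by
  have hα0 : 0 < α := by linarith
  have hδ : 0 < 2 / α := by positivity
  have hkπ : 0 < Real.pi * k ^ (2 / α) := by positivity
  induction t with
  | top => simp [ENNReal.top_rpow_of_neg (neg_lt_zero.2 hδ)]
  | coe t =>
    obtain rfl | ht := eq_zero_or_pos t
    · have : {x : Plane | ((0 : ℝ≥0) : ℝ≥0∞) < ENNReal.ofReal (‖x‖ ^ (-α) * k)} = {0}ᶜ := by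
        ext x
        simp only [ENNReal.coe_zero, ENNReal.ofReal_pos, Set.mem_ofPred_eq, Set.mem_compl_iff,
          Set.mem_singleton_iff]
        constructor
        · rintro h rfl
          rw [norm_zero, Real.zero_rpow (by linarith), zero_mul] at h
          exact h.false
        · intro h
          have := norm_pos_iff.2 h
          positivity
      rw [this, ENNReal.coe_zero, ENNReal.zero_rpow_of_neg (neg_lt_zero.2 hδ),
        ENNReal.mul_top (ENNReal.ofReal_pos.2 hkπ).ne', measure_compl (measurableSet_singleton _)
          (by simp)]
      simp [measure_univ_of_isAddLeftInvariant]
    · have ht' : (0 : ℝ) < t := ht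
      have : {x : Plane | (t : ℝ≥0∞) < ENNReal.ofReal (‖x‖ ^ (-α) * k)} =
          Metric.ball 0 ((k / t) ^ (1 / α)) \ {0} := by
        ext x
        rw [Set.mem_ofPred_eq, ← ENNReal.ofReal_coe_nnreal, ENNReal.ofReal_lt_ofReal_iff_of_nonneg
          t.coe_nonneg, Set.mem_sdiff, mem_ball_zero_iff, Set.mem_singleton_iff]
        by_cases hx : x = 0
        · simp only [hx, norm_zero, not_true, and_false, iff_false, not_lt]
          rw [Real.zero_rpow (by linarith), zero_mul]
          exact ht'.le
        · have hx' := norm_pos_iff.2 hx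
          simp only [hx, not_false_eq_true, and_true]
          rw [one_div, Real.lt_rpow_inv_iff_of_pos hx'.le (by positivity) hα0, lt_div_iff₀ ht',
            Real.rpow_neg hx'.le, inv_mul_eq_div, lt_div_iff₀ (by positivity), mul_comm]
      rw [this, measure_sdiff_null (by simp), EuclideanSpace.volume_ball, Fintype.card_fin]
      have h1 : Real.Gamma ((2 : ℕ) / 2 + 1) = 1 := by
        norm_num
      rw [h1, ← ENNReal.ofReal_coe_nnreal, ENNReal.ofReal_rpow_of_pos ht',
        ← ENNReal.ofReal_pow (by positivity), ← ENNReal.ofReal_mul (by positivity),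
        ← ENNReal.ofReal_mul hkπ.le]
      congr 1
      rw [Real.sq_sqrt Real.pi_pos.le, ← Real.rpow_natCast ((k / t) ^ (1 / α)) 2, ← Real.rpow_mul
        (by positivity), Real.div_rpow hk.le ht'.le, Real.rpow_neg ht'.le]
      have h2 : 1 / α * ((2 : ℕ) : ℝ) = 2 / α := by push_cast; ring
      rw [h2]
      ring

/-- Layer cake with 1 - e^(-y) = ∫₀^y e^(-t) dt: the areas of the discs contribute t^(-δ), leaving
the integral of Γ(1-δ), which converges because α > 2. -/
lemma lintegral_one_sub_expNeg_pathLoss {α : ℝ} (hα : 2 < α) {k : ℝ} (hk : 0 < k) :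
    ∫⁻ x : Plane, (1 - expNeg (ENNReal.ofReal (‖x‖ ^ (-α) * k))) =
      ENNReal.ofReal (Real.pi * k ^ (2 / α)) * ENNReal.ofReal (Real.Gamma (1 - 2 / α)) := by
  have hα0 : 0 < α := by linarith
  have hδ1 : 2 / α < 1 := by rw [div_lt_one hα0]; exact hα
  have hf : ∀ x : Plane, 0 ≤ ‖x‖ ^ (-α) * k := fun x => by positivity
  have h := lintegral_comp_eq_lintegral_meas_lt_mul (volume : Measure Plane)
    (f := fun x => ‖x‖ ^ (-α) * k) (g := fun t => Real.exp (-t)) (ae_of_all _ hf)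
    (by fun_prop) (fun t _ => Continuous.intervalIntegrable (by fun_prop) _ _)
    (ae_of_all _ fun t => (Real.exp_pos _).le)
  have e1 : ∀ x : Plane, 1 - expNeg (ENNReal.ofReal (‖x‖ ^ (-α) * k)) =
      ENNReal.ofReal (∫ t in (0 : ℝ)..‖x‖ ^ (-α) * k, Real.exp (-t)) := by
    intro x
    rw [one_sub_expNeg_ofReal (hf x), intervalIntegral.integral_comp_neg (fun t => Real.exp t),
      integral_exp, neg_zero, Real.exp_zero]
  simp_rw [e1]
  rw [h]
  have e2 : ∀ t ∈ Set.Ioi (0 : ℝ), volume {x : Plane | t < ‖x‖ ^ (-α) * k} *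
      ENNReal.ofReal (Real.exp (-t)) = ENNReal.ofReal (Real.pi * k ^ (2 / α)) *
        ENNReal.ofReal (Real.exp (-t) * t ^ ((1 - 2 / α) - 1)) := by
    intro t ht
    have ht : 0 < t := ht
    have : {x : Plane | t < ‖x‖ ^ (-α) * k} =
        {x : Plane | ENNReal.ofReal t < ENNReal.ofReal (‖x‖ ^ (-α) * k)} := by
      ext x
      rw [Set.mem_ofPred_eq, Set.mem_ofPred_eq, ENNReal.ofReal_lt_ofReal_iff_of_nonneg ht.le]
    rw [this, volume_lt_pathLoss hα hk, mul_assoc, ENNReal.ofReal_rpow_of_pos ht,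
      ← ENNReal.ofReal_mul (by positivity), sub_sub_cancel_left, mul_comm (t ^ _)]
  rw [setLIntegral_congr_fun measurableSet_Ioi e2, lintegral_const_mul _ (by fun_prop)]
  congr 1
  refine setLIntegral_ofReal_eq_of_setIntegral_eq measurableSet_Ioi
    (fun t ht => ?_) (Real.Gamma_pos_of_pos (by linarith)).ne'
    (Real.Gamma_eq_integral (by linarith)).symm
  have ht : 0 < t := ht
  positivity

lemma measurable_gammaPDF (a r : ℝ) : Measurable (gammaPDF a r) :=
  (measurable_gammaPDFReal a r).ennreal_ofReal

lemma ae_pos_gammaMeasure {m : ℕ} : ∀ᵐ g ∂(gammaMeasure m m), 0 < g := by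
  rw [gammaMeasure, ae_withDensity_iff (measurable_gammaPDF _ _)]
  have h0 : ∀ᵐ g : ℝ, g ≠ 0 := by simp [ae_iff]
  filter_upwards [h0] with g hg h
  by_contra hn
  exact h (gammaPDF_of_neg (lt_of_le_of_ne (not_lt.1 hn) hg))

lemma lintegral_rpow_gammaMeasure {m : ℕ} (hm : 0 < m) {δ : ℝ} (hδ : 0 < δ) :
    ∫⁻ g, ENNReal.ofReal (g ^ δ) ∂(gammaMeasure m m) =
      ENNReal.ofReal ((m : ℝ) ^ (-δ) * (Real.Gamma (m + δ) / Real.Gamma m)) := by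
  have hm' : (0 : ℝ) < m := by exact_mod_cast hm
  have hΓ := Real.Gamma_pos_of_pos hm'
  have hΓ' := Real.Gamma_pos_of_pos (add_pos hm' hδ)
  have hmeas : Measurable fun g : ℝ => ENNReal.ofReal (g ^ δ) := by fun_prop
  rw [gammaMeasure, lintegral_withDensity_eq_lintegral_mul _
    (measurable_gammaPDF _ _) hmeas]
  have hz : ∀ g : ℝ, g ∉ Set.Ioi (0 : ℝ) →
      (gammaPDF m m * fun g : ℝ => ENNReal.ofReal (g ^ δ)) g = 0 := by
    intro g hg
    have hg : g ≤ 0 := not_lt.1 hg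
    obtain rfl | h := eq_or_lt_of_le hg
    · simp [Real.zero_rpow hδ.ne']
    · simp [gammaPDF_of_neg h]
  rw [← setLIntegral_eq_of_support_subset (s := Set.Ioi (0 : ℝ))
    (fun g hg => by_contra fun h => hg (hz g h))]
  have e : ∀ g ∈ Set.Ioi (0 : ℝ), (gammaPDF m m * fun g : ℝ => ENNReal.ofReal (g ^ δ)) g =
      ENNReal.ofReal ((m : ℝ) ^ (m : ℝ) / Real.Gamma m *
        (g ^ ((m + δ) - 1) * Real.exp (-(m * g)))) := by
    intro g hg
    have hg : 0 < g := hg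
    rw [Pi.mul_apply, gammaPDF_of_nonneg hg.le, ← ENNReal.ofReal_mul (by positivity)]
    congr 1
    have : g ^ ((m + δ) - 1) = g ^ ((m : ℝ) - 1) * g ^ δ := by
      rw [← Real.rpow_add hg]; congr 1; ring
    rw [this]
    ring
  rw [setLIntegral_congr_fun measurableSet_Ioi e]
  refine setLIntegral_ofReal_eq_of_setIntegral_eq measurableSet_Ioi (fun g hg => ?_)
    (by positivity) ?_
  · have hg : 0 < g := hg
    positivity
  · rw [integral_const_mul, Real.integral_rpow_mul_exp_neg_mul_Ioi (by positivity) hm',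
      one_div, Real.inv_rpow hm'.le, Real.rpow_add hm', Real.rpow_neg hm'.le]
    field_simp

lemma lintegral_lossAt {α : ℝ} (hα : 2 < α) {mi : ℕ} (hmi : 0 < mi) {s : ℝ} (hs : 0 < s) :
    ∫⁻ x, lossAt α mi (ENNReal.ofReal s) x =
      ENNReal.ofReal (Real.pi * deltaI mi α * s ^ (2 / α)) := by
  have := isProbabilityMeasure_gammaMeasure_nat hmi
  have hα0 : 0 < α := by linarith
  have hδ : 0 < 2 / α := by positivity
  have hδ1 : 2 / α < 1 := by rw [div_lt_one hα0]; exact hα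
  unfold lossAt
  rw [lintegral_lintegral_swap (by
    refine Measurable.aemeasurable ?_
    unfold Function.uncurry
    fun_prop)]
  have e : ∀ᵐ g ∂(gammaMeasure mi mi),
      ∫⁻ x : Plane, (1 - expNeg (ENNReal.ofReal s * ENNReal.ofReal (‖x‖ ^ (-α) * g))) =
        ENNReal.ofReal (Real.pi * s ^ (2 / α)) * ENNReal.ofReal (Real.Gamma (1 - 2 / α)) *
          ENNReal.ofReal (g ^ (2 / α)) := by
    filter_upwards [ae_pos_gammaMeasure] with g hg
    simp_rw [← ENNReal.ofReal_mul hs.le, mul_left_comm s]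
    rw [lintegral_one_sub_expNeg_pathLoss hα (by positivity), mul_right_comm]
    congr 1
    rw [Real.mul_rpow hs.le hg.le, ← mul_assoc, ENNReal.ofReal_mul (by positivity)]
  rw [lintegral_congr_ae e, lintegral_const_mul _ (by fun_prop),
    lintegral_rpow_gammaMeasure hmi hδ, ← ENNReal.ofReal_mul (by positivity),
    ← ENNReal.ofReal_mul (mul_nonneg (by positivity) (Real.Gamma_pos_of_pos (by linarith)).le)]
  congr 1
  unfold deltaI
  ring

/-- Gamma's integral, rescaled; it converts a Laplace transform into a negative moment. At y = 0
both sides are ∞, at y = ∞ both are 0. -/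
lemma lintegral_rpow_mul_expNeg {δ : ℝ} (hδ : 0 < δ) (y : ℝ≥0∞) :
    ∫⁻ t in Set.Ioi (0 : ℝ), ENNReal.ofReal (t ^ (δ - 1)) * expNeg (ENNReal.ofReal t * y) =
      ENNReal.ofReal (Real.Gamma δ) * y ^ (-δ) := by
  have hΓ := Real.Gamma_pos_of_pos hδ
  induction y with
  | top =>
    rw [ENNReal.top_rpow_of_neg (neg_lt_zero.2 hδ), mul_zero,
      setLIntegral_congr_fun (g := fun _ => 0) measurableSet_Ioi]
    · simp
    · intro t ht
      have ht : 0 < t := ht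
      simp [ENNReal.mul_top, ht]
  | coe y =>
    obtain rfl | hy := eq_zero_or_pos y
    · rw [ENNReal.coe_zero, ENNReal.zero_rpow_of_neg (neg_lt_zero.2 hδ),
        ENNReal.mul_top (ENNReal.ofReal_pos.2 hΓ).ne']
      simp only [mul_zero, expNeg_zero, mul_one]
      by_contra hne
      refine not_integrableOn_Ioi_rpow (δ - 1) ?_
      refine (lintegral_ofReal_ne_top_iff_integrable ?_ ?_).1 hne
      · exact (by fun_prop : Measurable fun t : ℝ => t ^ (δ - 1)).aestronglyMeasurable
      · refine (ae_restrict_iff' measurableSet_Ioi).2 (ae_of_all _ fun t ht => ?_)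
        exact Real.rpow_nonneg (le_of_lt ht) _
    · have hy' : (0 : ℝ) < y := hy
      have e : ∀ t ∈ Set.Ioi (0 : ℝ),
          ENNReal.ofReal (t ^ (δ - 1)) * expNeg (ENNReal.ofReal t * y) =
            ENNReal.ofReal (t ^ (δ - 1) * Real.exp (-(y * t))) := by
        intro t ht
        have ht : 0 < t := ht
        rw [← ENNReal.ofReal_coe_nnreal, ← ENNReal.ofReal_mul ht.le, expNeg_ofReal (by positivity),
          ← ENNReal.ofReal_mul (by positivity), mul_comm t]
      rw [setLIntegral_congr_fun measurableSet_Ioi e, ← ENNReal.ofReal_coe_nnreal,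
        ENNReal.ofReal_rpow_of_pos hy', ← ENNReal.ofReal_mul hΓ.le]
      refine setLIntegral_ofReal_eq_of_setIntegral_eq measurableSet_Ioi (fun t ht => ?_)
        (by positivity) ?_
      · have ht : 0 < t := ht
        positivity
      · rw [Real.integral_rpow_mul_exp_neg_mul_Ioi hδ hy', one_div, Real.inv_rpow hy'.le,
          Real.rpow_neg hy'.le, mul_comm]

lemma lintegral_rpow_mul_expNeg_rpow {δ c : ℝ} (hδ : 0 < δ) (hc : 0 < c) :
    ∫⁻ t in Set.Ioi (0 : ℝ), ENNReal.ofReal (t ^ (δ - 1)) * expNeg (ENNReal.ofReal (c * t ^ δ)) =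
      ENNReal.ofReal (1 / (δ * c)) := by
  have e : ∀ t ∈ Set.Ioi (0 : ℝ),
      ENNReal.ofReal (t ^ (δ - 1)) * expNeg (ENNReal.ofReal (c * t ^ δ)) =
        ENNReal.ofReal (t ^ (δ - 1) * Real.exp (-c * t ^ δ)) := by
    intro t ht
    have ht : 0 < t := ht
    rw [expNeg_ofReal (by positivity), ← ENNReal.ofReal_mul (by positivity), neg_mul]
  rw [setLIntegral_congr_fun measurableSet_Ioi e]
  refine setLIntegral_ofReal_eq_of_setIntegral_eq measurableSet_Ioi (fun t ht => ?_)
    (by positivity) ?_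
  · have ht : 0 < t := ht
    positivity
  · rw [integral_rpow_mul_exp_neg_mul_rpow hδ (by linarith) hc, sub_add_cancel,
      div_self hδ.ne', neg_div, div_self hδ.ne', Real.Gamma_one, Real.rpow_neg_one]
    field_simp

/-! ### Capture events and their joint intensity. -/

namespace HelloNetwork

variable {Ω : Type*} {M : ℕ} {N : HelloNetwork Ω M}

/-- Node `i` transmits on resource block `b` and its signal exceeds `ξ` times the interference. -/
def captureSet (N : HelloNetwork Ω M) (α ξ : ℝ) (b : Fin M) (i : ℕ) : Set Ω :=
  {ω | ((N.mark i ω).1 = true ∧ (N.mark i ω).2.1 = b) ∧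
    ENNReal.ofReal ξ * N.blockInterference α b i ω < ENNReal.ofReal (‖N.X i ω‖ ^ (-α) * N.h i ω)}

lemma interference_eq_blockInterference (α : ℝ) (i : ℕ) (ω : Ω) :
    N.interference α i ω = N.blockInterference α (N.B i ω) i ω := by
  rw [interference, blockInterference,
    tsum_subtype (N.interferers i ω) fun j => ENNReal.ofReal (‖N.X j ω‖ ^ (-α) * N.g j ω)]
  refine tsum_congr fun j => ?_
  by_cases h1 : j = i <;> by_cases h2 : N.Z j ω = true <;> by_cases h3 : N.B j ω = N.B i ω <;>
    simp [Set.indicator, interferers, blockPower, mark, h1, h2, h3]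

lemma mem_discovered_iff {α ξ : ℝ} (hξ : 0 < ξ) {i : ℕ} {ω : Ω} :
    i ∈ N.discovered α 0 ξ ω ↔ N.Z₀ ω = false ∧ ω ∈ N.captureSet α ξ (N.B i ω) i := by
  simp only [discovered, captureSet, Set.mem_ofPred_eq, mark, sinr, ENNReal.coe_zero, add_zero,
    and_true, interference_eq_blockInterference]
  refine and_congr_right fun _ => and_congr_right fun _ => ?_
  set y := N.blockInterference α (N.B i ω) i ω
  set a := ENNReal.ofReal (‖N.X i ω‖ ^ (-α) * N.h i ω)
  -- With no interference, a/0 is ∞ for a > 0 and 0 for a = 0, which agrees with the product form 0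
  -- < a.
  by_cases hy : y = 0
  · by_cases ha : a = 0
    · simp [hy, ha]
    · simp [hy, ENNReal.div_zero ha, pos_iff_ne_zero, ha]
  · exact ENNReal.lt_div_iff_mul_lt (Or.inl hy) (Or.inr (ENNReal.ofReal_pos.2 hξ).ne')

lemma indicator_discovered (α : ℝ) {ξ : ℝ} (hξ : 0 < ξ) (i : ℕ) (ω : Ω) :
    (N.discovered α 0 ξ ω).indicator (fun _ => (1 : ℝ≥0∞)) i =
      (if N.Z₀ ω = false then 1 else 0) *
        ∑ b, (N.captureSet α ξ b i).indicator (fun _ => (1 : ℝ≥0∞)) ω := by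
  rw [Finset.sum_eq_single (N.B i ω)]
  · by_cases h0 : N.Z₀ ω = false <;> by_cases h : ω ∈ N.captureSet α ξ (N.B i ω) i <;>
      simp [Set.indicator, mem_discovered_iff hξ, h0, h]
  · intro b _ hb
    refine Set.indicator_of_notMem ?_ _
    rintro ⟨⟨-, h⟩, -⟩
    exact hb h.symm
  · simp

variable [MeasurableSpace Ω] {P : Measure Ω} {lam : ℝ≥0} {ρ : ℝ} {ms mi : ℕ}

namespace IsNakagamiModel

lemma measurable_blockInterference (hN : N.IsNakagamiModel P lam ρ ms mi) (α : ℝ) (b : Fin M)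
    (i : ℕ) : Measurable (N.blockInterference α b i) := by
  refine Measurable.tsum fun j => ?_
  by_cases hj : j = i
  · simp [hj]
  · simpa [hj, Function.comp_def] using (measurable_blockPower α b).comp
      ((hN.ppp.measurable j).prodMk (hN.measurable_mark j))

lemma measurable_blockTotal (hN : N.IsNakagamiModel P lam ρ ms mi) (α : ℝ) (b : Fin M) :
    Measurable (N.blockTotal α b) :=
  Measurable.tsum fun j =>
    (measurable_blockPower α b).comp ((hN.ppp.measurable j).prodMk (hN.measurable_mark j))

lemma measurableSet_captureSet (hN : N.IsNakagamiModel P lam ρ ms mi) (α ξ : ℝ) (b : Fin M)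
    (i : ℕ) : MeasurableSet (N.captureSet α ξ b i) := by
  refine (hN.measurable_mark i (measurableSet_onBlock b)).inter (measurableSet_lt
    ((hN.measurable_blockInterference α b i).const_mul _) ?_)
  exact (((hN.ppp.measurable i).norm.pow_const _).mul (hN.measurable_h i)).ennreal_ofReal

lemma indepFun_captureSet (hN : N.IsNakagamiModel P lam ρ ms mi) (α ξ : ℝ) (b : Fin M) (i : ℕ) :
    IndepFun N.Z₀ ((N.captureSet α ξ b i).indicator fun _ => (1 : ℝ≥0∞)) P := by
  let T : Set ((ℕ → Plane) × (ℕ → Bool × Fin M × ℝ × ℝ)) :=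
    {p | (p.2 i).1 = true ∧ (p.2 i).2.1 = b} ∩
    {p | ENNReal.ofReal ξ * (∑' j, if j = i then 0 else blockPower α b (p.1 j) (p.2 j)) <
        ENNReal.ofReal (‖p.1 i‖ ^ (-α) * (p.2 i).2.2.1)}
  have h2 : Measurable fun p : (ℕ → Plane) × (ℕ → Bool × Fin M × ℝ × ℝ) => p.2 i :=
    (measurable_pi_apply i).comp measurable_snd
  have h1 : Measurable fun p : (ℕ → Plane) × (ℕ → Bool × Fin M × ℝ × ℝ) => p.1 i :=
    (measurable_pi_apply i).comp measurable_fst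
  have hT : MeasurableSet T := by
    refine (h2 (measurableSet_onBlock b)).inter (measurableSet_lt
      ((Measurable.tsum fun j => ?_).const_mul _) ?_)
    · by_cases hj : j = i
      · simp [hj]
      · simpa [hj] using measurable_blockPower_node α b j
    · exact ((h1.norm.pow_const _).mul h2.snd.snd.fst).ennreal_ofReal
  exact hN.indep_Z₀.comp measurable_id (measurable_const.indicator hT (f := fun _ => (1 : ℝ≥0∞)))

lemma meanDiscovered_eq [IsProbabilityMeasure P] (hN : N.IsNakagamiModel P lam ρ ms mi)
    (hρ : 0 ≤ ρ) (α : ℝ) {ξ : ℝ} (hξ : 0 < ξ) :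
    N.meanDiscovered P α 0 ξ =
      ENNReal.ofReal (1 - ρ) * ∑ b, ∑' i, P (N.captureSet α ξ b i) := by
  have hZ : Measurable fun ω => if N.Z₀ ω = false then (1 : ℝ≥0∞) else 0 :=
    (Measurable.of_discrete (f := fun z : Bool => if z = false then (1 : ℝ≥0∞) else 0)).comp
      hN.measurable_Z₀
  have hC : ∀ b i, Measurable ((N.captureSet α ξ b i).indicator fun _ => (1 : ℝ≥0∞)) :=
    fun b i => measurable_const.indicator (hN.measurableSet_captureSet α ξ b i)
  have hP : ∫⁻ ω, (if N.Z₀ ω = false then (1 : ℝ≥0∞) else 0) ∂P = ENNReal.ofReal (1 - ρ) := by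
    have hset : MeasurableSet {ω | N.Z₀ ω = true} :=
      hN.measurable_Z₀ (measurableSet_singleton true)
    have e : ∀ ω, (if N.Z₀ ω = false then (1 : ℝ≥0∞) else 0) =
        ({ω | N.Z₀ ω = true}ᶜ).indicator 1 ω := by
      intro ω
      by_cases h : N.Z₀ ω = true <;> simp [h]
    simp_rw [e]
    rw [lintegral_indicator_one hset.compl, prob_compl_eq_one_sub hset, hN.law_Z₀,
      ENNReal.ofReal_sub _ hρ, ENNReal.ofReal_one]
  unfold meanDiscovered numDiscovered
  simp_rw [encard_setOf_eq_tsum, indicator_discovered α hξ, Finset.mul_sum]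
  rw [lintegral_tsum fun i => (Finset.measurable_fun_sum _ fun b _ =>
    hZ.fun_mul (hC b i)).aemeasurable, ← Finset.mul_sum,
    ← Summable.tsum_finsetSum fun b _ => ENNReal.summable, ← ENNReal.tsum_mul_left]
  refine tsum_congr fun i => ?_
  rw [lintegral_finsetSum _ fun b _ => hZ.fun_mul (hC b i), Finset.mul_sum]
  refine Finset.sum_congr rfl fun b _ => ?_
  rw [lintegral_mul_eq_lintegral_mul_lintegral_of_indepFun'' hZ.aemeasurable (hC b i).aemeasurable
    ((hN.indepFun_captureSet α ξ b i).comp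
      (Measurable.of_discrete (f := fun z : Bool => if z = false then (1 : ℝ≥0∞) else 0))
      measurable_id), hP]
  congr 1
  exact lintegral_indicator_one (hN.measurableSet_captureSet α ξ b i)

/-- Nodes on block `b` with a given location and gain see interference distributed as the total
power on the block. -/
lemma tsum_measure_onBlock_of_finite [IsProbabilityMeasure P]
    (hN : N.IsNakagamiModel P lam ρ ms mi) (hms : 0 < ms) (hmi : 0 < mi) (hρ : ρ < 1) (α : ℝ)
    (b : Fin M) {D : Set (Plane × ℝ)} (hD : MeasurableSet D)
    (hD' : ((volume : Measure Plane).prod (gammaMeasure ms ms)) D ≠ ∞) {B : Set ℝ≥0∞}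
    (hB : MeasurableSet B) :
    ∑' i, P ({ω | ((N.mark i ω).1 = true ∧ (N.mark i ω).2.1 = b) ∧ (N.X i ω, N.h i ω) ∈ D} ∩
        N.blockInterference α b i ⁻¹' B) =
      lam * (ENNReal.ofReal ρ * (M : ℝ≥0∞)⁻¹ *
        ((volume : Measure Plane).prod (gammaMeasure ms ms)) D) *
          P.map (N.blockTotal α b) B := by
  set κ := (volume : Measure Plane).prod (gammaMeasure ms ms)
  set c := lam * (ENNReal.ofReal ρ * (M : ℝ≥0∞)⁻¹ * κ D) with hc
  have hcfin : c ≠ ∞ := ENNReal.mul_ne_top ENNReal.coe_ne_top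
    (ENNReal.mul_ne_top ((block_prob_lt_one hρ b).trans ENNReal.one_lt_top).ne hD')
  let E : ℕ → Set Ω := fun i =>
    {ω | ((N.mark i ω).1 = true ∧ (N.mark i ω).2.1 = b) ∧ (N.X i ω, N.h i ω) ∈ D}
  have hE : ∀ i, MeasurableSet (E i) := fun i =>
    (hN.measurable_mark i (measurableSet_onBlock b)).inter
      (((hN.ppp.measurable i).prodMk (hN.measurable_h i)) hD)
  have hJ := hN.measurable_blockInterference α b
  have hT := hN.measurable_blockTotal α b
  -- The summed law of the interference seen by the selected nodes. It is compared with the law of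
  -- the total power through Laplace transforms; s = 0 shows that it is finite.
  let ν : Measure ℝ≥0∞ := Measure.sum fun i => (P.restrict (E i)).map (N.blockInterference α b i)
  have hlap : ∀ s : ℝ≥0∞, ∫⁻ y, expNeg (s * y) ∂ν =
      ∫⁻ y, expNeg (s * y) ∂(c • P.map (N.blockTotal α b)) := by
    intro s
    have hs : Measurable fun y => expNeg (s * y) := (measurable_id.const_mul s).expNeg
    rw [lintegral_sum_measure, lintegral_smul_measure, lintegral_map hs hT, smul_eq_mul, hc,
      ← hN.tsum_lintegral_expNeg_blockInterference hms hmi hρ α b s hD]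
    refine tsum_congr fun i => ?_
    rw [lintegral_map hs (hJ i), ← lintegral_indicator (hE i)]
    refine lintegral_congr fun ω => ?_
    by_cases h1 : (N.mark i ω).1 = true ∧ (N.mark i ω).2.1 = b <;>
      by_cases h2 : (N.X i ω, N.h i ω) ∈ D
    · have h2' : (N.X i ω, (N.mark i ω).2.2.1) ∈ D := h2
      have : ω ∈ E i := ⟨h1, h2⟩
      simp [this, h1, h2']
    · have h2' : (N.X i ω, (N.mark i ω).2.2.1) ∉ D := h2
      have : ω ∉ E i := fun h => h2 h.2
      simp [this, h2']
    · have : ω ∉ E i := fun h => h1 h.1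
      simp [this, h1]
    · have : ω ∉ E i := fun h => h1 h.1
      simp [this, h1]
  have hprob : IsProbabilityMeasure (P.map (N.blockTotal α b)) :=
    Measure.isProbabilityMeasure_map hT.aemeasurable
  have hfin2 : IsFiniteMeasure (c • P.map (N.blockTotal α b)) :=
    Measure.smul_finite _ hcfin
  have hfin1 : IsFiniteMeasure ν := by
    refine ⟨?_⟩
    have := hlap 0
    simp only [zero_mul, expNeg_zero, lintegral_one] at this
    rw [this]
    exact measure_lt_top _ _
  have hν := measure_ext_of_lintegral_expNeg fun n => hlap n
  have h := congrArg (fun μ => μ B) hν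
  simp only [Measure.smul_apply, smul_eq_mul] at h
  rw [← h, Measure.sum_apply _ hB]
  refine tsum_congr fun i => ?_
  rw [Measure.map_apply (hJ i) hB, Measure.restrict_apply (hJ i hB), Set.inter_comm]

/-- Mecke's equation for the marked process, in the form of a product measure: under the summed law,
location, desired gain and interference decouple. The own gain `g i` never enters the interference
at `i`, so its dependence on `h i` is irrelevant. -/
lemma sum_map_onBlock [IsProbabilityMeasure P]
    (hN : N.IsNakagamiModel P lam ρ ms mi) (hms : 0 < ms) (hmi : 0 < mi) (hρ : ρ < 1) (α : ℝ)
    (b : Fin M) :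
    Measure.sum (fun i => (P.restrict {ω | (N.mark i ω).1 = true ∧ (N.mark i ω).2.1 = b}).map
        fun ω => ((N.X i ω, N.h i ω), N.blockInterference α b i ω)) =
      ((volume : Measure Plane).prod (gammaMeasure ms ms)).prod
        ((lam * (ENNReal.ofReal ρ * (M : ℝ≥0∞)⁻¹)) • P.map (N.blockTotal α b)) := by
  have hγ := isProbabilityMeasure_gammaMeasure_nat hms
  have hprob : IsProbabilityMeasure (P.map (N.blockTotal α b)) :=
    Measure.isProbabilityMeasure_map (hN.measurable_blockTotal α b).aemeasurable
  have hcfin : lam * (ENNReal.ofReal ρ * (M : ℝ≥0∞)⁻¹) ≠ ∞ := ENNReal.mul_ne_top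
    ENNReal.coe_ne_top ((block_prob_lt_one hρ b).trans ENNReal.one_lt_top).ne
  have hfin : IsFiniteMeasure
      ((lam * (ENNReal.ofReal ρ * (M : ℝ≥0∞)⁻¹)) • P.map (N.blockTotal α b)) :=
    Measure.smul_finite _ hcfin
  set κ := (volume : Measure Plane).prod (gammaMeasure ms ms) with hκ
  have hF : ∀ i, Measurable fun ω => ((N.X i ω, N.h i ω), N.blockInterference α b i ω) :=
    fun i => ((hN.ppp.measurable i).prodMk (hN.measurable_h i)).prodMk
      (hN.measurable_blockInterference α b i)
  refine (Measure.prod_eq fun D B hD hB => ?_).symm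
  -- The previous lemma needs sets of finite measure; a general `D` is exhausted by its parts over
  -- balls.
  let K : ℕ → Set (Plane × ℝ) := fun n => Metric.ball (0 : Plane) n ×ˢ Set.univ
  have hK : ∀ n, MeasurableSet (K n) := fun n => Metric.isOpen_ball.measurableSet.prod .univ
  have hKmono : Monotone K := fun n m hnm =>
    Set.prod_mono (Metric.ball_subset_ball (by exact_mod_cast hnm)) subset_rfl
  have hKU : ⋃ n, K n = Set.univ := by
    rw [← Set.iUnion_prod_const, Metric.iUnion_ball_nat, Set.univ_prod_univ]
  have hDU : D = ⋃ n, D ∩ K n := by rw [← Set.inter_iUnion, hKU, Set.inter_univ]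
  have hDmono : Monotone fun n => D ∩ K n := fun n m hnm => Set.inter_subset_inter_right _ (hKmono hnm)
  have key : ∀ n, Measure.sum (fun i =>
      (P.restrict {ω | (N.mark i ω).1 = true ∧ (N.mark i ω).2.1 = b}).map
        fun ω => ((N.X i ω, N.h i ω), N.blockInterference α b i ω)) ((D ∩ K n) ×ˢ B) =
      κ (D ∩ K n) * ((lam * (ENNReal.ofReal ρ * (M : ℝ≥0∞)⁻¹)) • P.map (N.blockTotal α b)) B := by
    intro n
    have hDK := hD.inter (hK n)
    have hfinK : κ (D ∩ K n) ≠ ∞ := by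
      refine ne_top_of_le_ne_top ?_ (measure_mono Set.inter_subset_right)
      rw [hκ, Measure.prod_prod, measure_univ, mul_one]
      exact measure_ball_lt_top.ne
    have h := hN.tsum_measure_onBlock_of_finite hms hmi hρ α b hDK hfinK hB
    rw [Measure.sum_apply _ (hDK.prod hB), Measure.smul_apply, smul_eq_mul, ← mul_assoc,
      mul_comm (κ _), mul_assoc (lam : ℝ≥0∞), ← h]
    refine tsum_congr fun i => ?_
    rw [Measure.map_apply (hF i) (hDK.prod hB), Measure.restrict_apply (hF i (hDK.prod hB))]
    congr 1
    ext ω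
    simp only [Set.mem_inter_iff, Set.mem_preimage, Set.mem_prod, Set.mem_ofPred_eq]
    tauto
  rw [hDU, Set.iUnion_prod_const, Monotone.measure_iUnion hDmono, Monotone.measure_iUnion
    (fun n m hnm => Set.prod_mono (hDmono hnm) subset_rfl), ENNReal.iSup_mul]
  exact iSup_congr key

end IsNakagamiModel

end HelloNetwork

/-! ### The constants and the final evaluation. -/

lemma deltaI_pos {m : ℕ} (hm : 0 < m) {α : ℝ} (hα : 2 < α) : 0 < deltaI m α := by
  have hm' : (0 : ℝ) < m := by exact_mod_cast hm
  have hα0 : 0 < α := by linarith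
  have hδ : 0 < 2 / α := by positivity
  have hδ1 : 2 / α < 1 := by rw [div_lt_one hα0]; exact hα
  have h1 := Real.Gamma_pos_of_pos hm'
  have h2 := Real.Gamma_pos_of_pos (sub_pos.2 hδ1)
  have h3 := Real.Gamma_pos_of_pos (add_pos hm' hδ)
  unfold deltaI
  positivity

/-- The factors in m cancel, leaving 1/(Γ(1+δ)Γ(1-δ)); then Γ(1+δ) = δΓ(δ) and Euler's reflection
formula apply. -/
lemma deltaS_div_deltaI_self {m : ℕ} (hm : 0 < m) {α : ℝ} (hα : 2 < α) :
    deltaS m α / deltaI m α = Real.sin (2 * Real.pi / α) / (2 * Real.pi / α) := by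
  have hm' : (0 : ℝ) < m := by exact_mod_cast hm
  have hα0 : 0 < α := by linarith
  have hδ : 0 < 2 / α := by positivity
  have hδ1 : 2 / α < 1 := by rw [div_lt_one hα0]; exact hα
  have h1 := Real.Gamma_pos_of_pos hm'
  have h2 := Real.Gamma_pos_of_pos (sub_pos.2 hδ1)
  have h3 := Real.Gamma_pos_of_pos (add_pos hm' hδ)
  have h4 := Real.Gamma_pos_of_pos hδ
  have h5 := Real.rpow_pos_of_pos hm' (-(2 / α))
  have e : 2 * Real.pi / α = Real.pi * (2 / α) := by ring
  have hsin : 0 < Real.sin (Real.pi * (2 / α)) := by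
    refine Real.sin_pos_of_pos_of_lt_pi (by positivity) ?_
    nlinarith [Real.pi_pos]
  have href := Real.Gamma_mul_Gamma_one_sub (2 / α)
  have hadd : Real.Gamma (1 + 2 / α) = 2 / α * Real.Gamma (2 / α) := by
    rw [add_comm, Real.Gamma_add_one hδ.ne']
  unfold deltaS deltaI
  rw [hadd, e]
  set δ := 2 / α
  rw [eq_div_iff hsin.ne'] at href
  rw [div_eq_div_iff (by positivity) (by positivity)]
  field_simp
  rw [mul_comm δ Real.pi]
  linarith

lemma deltaS_mul_Gamma (m : ℕ) {α : ℝ} (hα : 0 < α) :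
    (m : ℝ) ^ (-(2 / α)) * (Real.Gamma (m + 2 / α) / Real.Gamma m) =
      deltaS m α * Real.Gamma (1 + 2 / α) := by
  have h := (Real.Gamma_pos_of_pos (show 0 < 1 + 2 / α by positivity)).ne'
  unfold deltaS
  rw [mul_assoc, div_mul_eq_mul_div, mul_comm (Real.Gamma (1 + 2 / α)), mul_div_mul_right _ _ h]

namespace HelloNetwork.IsNakagamiModel

variable {Ω : Type*} [MeasurableSpace Ω] {M : ℕ} {P : Measure Ω} {lam : ℝ≥0} {ρ : ℝ} {ms mi : ℕ}
  {N : HelloNetwork Ω M}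

/-- The fractional moment of order `-2/α` of the total power on a resource block. -/
lemma lintegral_blockTotal_rpow [IsProbabilityMeasure P]
    (hN : N.IsNakagamiModel P lam ρ ms mi) (hlam : 0 < lam) (hmi : 0 < mi) (hρ0 : 0 < ρ)
    (hρ : ρ < 1) {α : ℝ} (hα : 2 < α) (b : Fin M) :
    ∫⁻ ω, N.blockTotal α b ω ^ (-(2 / α)) ∂P =
      ENNReal.ofReal
        (1 / (Real.Gamma (1 + 2 / α) * (lam * (ρ / M) * (Real.pi * deltaI mi α)))) := by
  have hα0 : 0 < α := by linarith
  have hδ : 0 < 2 / α := by positivity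
  have hΓ := Real.Gamma_pos_of_pos hδ
  have hM : (0 : ℝ) < M := by exact_mod_cast b.pos
  have hI := deltaI_pos hmi hα
  have hlam' : (0 : ℝ) < lam := hlam
  have hT := hN.measurable_blockTotal α b
  -- The scale for which the total power has Laplace transform exp(-c t^δ).
  set c := lam * (ρ / M) * (Real.pi * deltaI mi α) with hc
  have hc0 : 0 < c := by positivity
  have e1 : ENNReal.ofReal (Real.Gamma (2 / α)) * ∫⁻ ω, N.blockTotal α b ω ^ (-(2 / α)) ∂P =
      ENNReal.ofReal (1 / (2 / α * c)) := by
    rw [← lintegral_const_mul _ (hT.pow_const _)]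
    simp_rw [← lintegral_rpow_mul_expNeg hδ]
    rw [lintegral_lintegral_swap (by
      refine Measurable.aemeasurable ?_
      refine Measurable.mul (f := fun p : Ω × ℝ => ENNReal.ofReal (p.2 ^ (2 / α - 1)))
        (by fun_prop) ?_
      exact ((measurable_snd.ennreal_ofReal).mul (hT.comp measurable_fst)).expNeg),
      ← lintegral_rpow_mul_expNeg_rpow hδ hc0]
    refine setLIntegral_congr_fun measurableSet_Ioi fun t ht => ?_
    have ht : 0 < t := ht
    rw [lintegral_const_mul _ (hT.const_mul _).expNeg,
      hN.lintegral_expNeg_blockTotal hmi hρ, lintegral_lossAt hα hmi ht]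
    congr 2
    rw [← ENNReal.ofReal_coe_nnreal, ← ENNReal.ofReal_natCast, ← ENNReal.ofReal_inv_of_pos hM,
      ← ENNReal.ofReal_mul hρ0.le, ← ENNReal.ofReal_mul (by positivity),
      ← ENNReal.ofReal_mul (by positivity)]
    congr 1
    rw [hc]
    ring
  have hΓ0 := (ENNReal.ofReal_pos.2 hΓ).ne'
  have e2 : ENNReal.ofReal (1 / (2 / α * c)) = ENNReal.ofReal (Real.Gamma (2 / α)) *
      ENNReal.ofReal (1 / (Real.Gamma (1 + 2 / α) * c)) := by
    rw [← ENNReal.ofReal_mul hΓ.le, add_comm, Real.Gamma_add_one hδ.ne']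
    congr 1
    field_simp
  rw [e2] at e1
  exact (ENNReal.mul_right_inj hΓ0 ENNReal.ofReal_ne_top).1 e1

lemma tsum_measure_captureSet [IsProbabilityMeasure P]
    (hN : N.IsNakagamiModel P lam ρ ms mi) (hlam : 0 < lam) (hms : 0 < ms) (hmi : 0 < mi)
    (hρ0 : 0 < ρ) (hρ : ρ < 1) {α : ℝ} (hα : 2 < α) {ξ : ℝ} (hξ : 0 < ξ) (b : Fin M) :
    ∑' i, P (N.captureSet α ξ b i) =
      ENNReal.ofReal (deltaS ms α / deltaI mi α / ξ ^ (2 / α)) := by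
  have hα0 : 0 < α := by linarith
  have hδ : 0 < 2 / α := by positivity
  have hM : (0 : ℝ) < M := by exact_mod_cast b.pos
  have hI := deltaI_pos hmi hα
  have hlam' : (0 : ℝ) < lam := hlam
  have hΓ := Real.Gamma_pos_of_pos (show 0 < 1 + 2 / α by positivity)
  have hms' : (0 : ℝ) < ms := by exact_mod_cast hms
  have hS : 0 < deltaS ms α := by
    have h1 := Real.Gamma_pos_of_pos hms'
    have h3 := Real.Gamma_pos_of_pos (add_pos hms' hδ)
    unfold deltaS
    positivity
  have hγ := isProbabilityMeasure_gammaMeasure_nat hms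
  have hT := hN.measurable_blockTotal α b
  let W : Set ((Plane × ℝ) × ℝ≥0∞) :=
    {p | ENNReal.ofReal ξ * p.2 < ENNReal.ofReal (‖p.1.1‖ ^ (-α) * p.1.2)}
  have hW : MeasurableSet W := measurableSet_lt (by fun_prop) (by fun_prop)
  have hF : ∀ i, Measurable fun ω => ((N.X i ω, N.h i ω), N.blockInterference α b i ω) :=
    fun i => ((hN.ppp.measurable i).prodMk (hN.measurable_h i)).prodMk
      (hN.measurable_blockInterference α b i)
  have h1 : ∑' i, P (N.captureSet α ξ b i) = Measure.sum (fun i =>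
      (P.restrict {ω | (N.mark i ω).1 = true ∧ (N.mark i ω).2.1 = b}).map
        fun ω => ((N.X i ω, N.h i ω), N.blockInterference α b i ω)) W := by
    rw [Measure.sum_apply _ hW]
    refine tsum_congr fun i => ?_
    rw [Measure.map_apply (hF i) hW, Measure.restrict_apply (hF i hW), Set.inter_comm]
    rfl
  have hprob : IsProbabilityMeasure (P.map (N.blockTotal α b)) :=
    Measure.isProbabilityMeasure_map hT.aemeasurable
  have hcfin : lam * (ENNReal.ofReal ρ * (M : ℝ≥0∞)⁻¹) ≠ ∞ := ENNReal.mul_ne_top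
    ENNReal.coe_ne_top ((block_prob_lt_one hρ b).trans ENNReal.one_lt_top).ne
  have hfin : IsFiniteMeasure
      ((lam * (ENNReal.ofReal ρ * (M : ℝ≥0∞)⁻¹)) • P.map (N.blockTotal α b)) :=
    Measure.smul_finite _ hcfin
  -- For interference level y, integrate the disc area π g^δ (ξ y)^(-δ) over the desired gain.
  have hsec : ∀ y : ℝ≥0∞, ((volume : Measure Plane).prod (gammaMeasure ms ms))
      ((fun x => (x, y)) ⁻¹' W) = ENNReal.ofReal (Real.pi * (deltaS ms α * Real.Gamma (1 + 2 / α)) *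
        ξ ^ (-(2 / α))) * y ^ (-(2 / α)) := by
    intro y
    rw [Measure.prod_apply_symm (measurable_prodMk_right hW)]
    have e : ∀ᵐ g ∂(gammaMeasure ms ms), volume ((fun x : Plane => (x, g)) ⁻¹'
        ((fun x => (x, y)) ⁻¹' W)) = ENNReal.ofReal Real.pi *
          (ENNReal.ofReal ξ * y) ^ (-(2 / α)) * ENNReal.ofReal (g ^ (2 / α)) := by
      filter_upwards [ae_pos_gammaMeasure] with g hg
      refine (volume_lt_pathLoss hα hg (ENNReal.ofReal ξ * y)).trans ?_
      rw [ENNReal.ofReal_mul Real.pi_pos.le]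
      ring
    have hξ' : ENNReal.ofReal ξ ≠ 0 := (ENNReal.ofReal_pos.2 hξ).ne'
    rw [lintegral_congr_ae e, lintegral_const_mul _ (by fun_prop),
      lintegral_rpow_gammaMeasure hms hδ, deltaS_mul_Gamma ms hα0, ENNReal.mul_rpow_eq_ite,
      if_neg (by simp [hξ']),
      ENNReal.ofReal_rpow_of_pos hξ, ENNReal.ofReal_mul
      (p := Real.pi * (deltaS ms α * Real.Gamma (1 + 2 / α))) (by positivity), ENNReal.ofReal_mul Real.pi_pos.le]
    ring
  have hpow : Measurable fun y : ℝ≥0∞ => y ^ (-(2 / α)) := by fun_prop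
  rw [h1, hN.sum_map_onBlock hms hmi hρ, Measure.prod_apply_symm hW]
  simp_rw [hsec]
  rw [lintegral_smul_measure, lintegral_const_mul _ hpow, lintegral_map hpow hT,
    hN.lintegral_blockTotal_rpow hlam hmi hρ0 hρ hα, smul_eq_mul,
    ← ENNReal.ofReal_coe_nnreal, ← ENNReal.ofReal_natCast, ← ENNReal.ofReal_inv_of_pos hM,
    ← ENNReal.ofReal_mul hρ0.le, ← ENNReal.ofReal_mul (by positivity),
    ← ENNReal.ofReal_mul (by positivity), ← ENNReal.ofReal_mul (by positivity)]
  congr 1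
  rw [Real.rpow_neg hξ.le]
  field_simp

end HelloNetwork.IsNakagamiModel

theorem proposition1 {Ω : Type*} [MeasurableSpace Ω] (P : Measure Ω) [IsProbabilityMeasure P]
    (lam : ℝ≥0) (hlam : 0 < lam) (ρ : ℝ) (hρ0 : 0 < ρ) (hρ1 : ρ ≤ 1) (M : ℕ) (hM : 0 < M)
    (ms mi : ℕ) (hms : 0 < ms) (hmi : 0 < mi) (α : ℝ) (hα : 2 < α) (ξ : ℝ) (hξ : 0 < ξ)
    (N : HelloNetwork Ω M) (hN : N.IsNakagamiModel P lam ρ ms mi) :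
    N.meanDiscovered P α 0 ξ =
        ENNReal.ofReal (deltaS ms α / deltaI mi α * (M * (1 - ρ) / ξ ^ (2 / α))) ∧
      (ms = mi →
        N.meanDiscovered P α 0 ξ =
          ENNReal.ofReal (Real.sin (2 * Real.pi / α) / (2 * Real.pi / α) *
            (M * (1 - ρ) / ξ ^ (2 / α)))) := by
  have main : N.meanDiscovered P α 0 ξ =
      ENNReal.ofReal (deltaS ms α / deltaI mi α * (M * (1 - ρ) / ξ ^ (2 / α))) := by
    rw [hN.meanDiscovered_eq hρ0.le α hξ]
    -- For ρ = 1 the typical node almost surely never receives and both sides vanish; the Mecke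
    -- argument requires ρ < 1.
    obtain rfl | hρ := eq_or_lt_of_le hρ1
    · simp
    · simp_rw [hN.tsum_measure_captureSet hlam hms hmi hρ0 hρ hα hξ]
      rw [Finset.sum_const, Finset.card_univ, Fintype.card_fin, nsmul_eq_mul,
        ← ENNReal.ofReal_natCast, ← ENNReal.ofReal_mul (by positivity),
        ← ENNReal.ofReal_mul (by linarith)]
      congr 1
      ring
  refine ⟨main, ?_⟩
  rintro rfl
  rw [main, deltaS_div_deltaI_self hms hα]
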